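/- For a digraph $D$ and a set $S\subseteq V(D)$ with $|S|\ge 2$, let $\kappa_S(D)$ be the maximum number $p$ of strongly connected subgraphs $D_1,\dots,D_p$ of $D$, each containing $S$, such that $V(D_i)\cap V(D_j)=S$ and $A(D_i)\cap A(D_j)=\emptyset$ for all $1\le i<j\le p$. For $2\le k\le |V(D)|$, let $\kappa_k(D)=\min\{\kappa_S(D) : S\subseteq V(D),\ |S|=k\}$ be the strong subgraph $k$-connectivity of $D$. For a graph $G$, let $\overleftrightarrow{G}$ be its complete biorientation, that is, the digraph obtained from $G$ by replacing each edge $xy$ by the two arcs $xy$ and $yx$. Then $\kappa_2(\overleftrightarrow{G})$ can be computed in polynomial time: there are an algorithm (a program of a random access machine with unit cost whose arithmetic operations are addition and subtraction) and a polynomial $q$ such that, for every finite simple graph $G$ with at least two vertices, given by its order and its adjacency matrix, the algorithm halts after at most $q(s)$ steps, where $s$ is the bit size of the input, and outputs $\kappa_2(\overleftrightarrow{G})$. -/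

import Mathlib

/-! ### Strong subgraph connectivity of digraphs -/

/-- A subgraph of a digraph `D`: a set of vertices and a set of arcs of `D` between them. -/
structure Digraph.Subdigraph {V : Type*} (D : Digraph V) where
  /-- the vertex set of the subgraph -/
  verts : Set V
  /-- the arc relation of the subgraph -/
  Adj : V → V → Prop
  adj_sub : ∀ {u v : V}, Adj u v → D.Adj u v
  fst_mem : ∀ {u v : V}, Adj u v → u ∈ verts
  snd_mem : ∀ {u v : V}, Adj u v → v ∈ verts

/-- A subgraph is strong if it has a vertex and every vertex can be reached from every vertex
along arcs of the subgraph. In particular, a one-vertex digraph is strong. -/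
def Digraph.Subdigraph.IsStrong {V : Type*} {D : Digraph V} (H : D.Subdigraph) : Prop :=
  H.verts.Nonempty ∧ ∀ u ∈ H.verts, ∀ v ∈ H.verts, Relation.ReflTransGen H.Adj u v

/-- `D` contains `p` strong subgraphs `H 0, …, H (p - 1)`, each containing `S`, which are
`S`-internally disjoint: any two of them share exactly the vertices of `S`, and no arc. -/
def Digraph.HasInternallyDisjointStrong {V : Type*} (D : Digraph V) (S : Finset V) (p : ℕ) :
    Prop :=
  ∃ H : Fin p → D.Subdigraph,
    (∀ i, (H i).IsStrong ∧ (S : Set V) ⊆ (H i).verts) ∧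
    ∀ i j, i < j →
      (H i).verts ∩ (H j).verts = (S : Set V) ∧ ∀ u v, ¬ ((H i).Adj u v ∧ (H j).Adj u v)

/-- `κ_S(D)`: the maximum number of `S`-internally disjoint strong subgraphs of `D` containing
`S`. For a finite digraph and `2 ≤ |S|` the maximum exists,
see `Digraph.isGreatest_localStrongConnectivity`. -/
noncomputable def Digraph.localStrongConnectivity {V : Type*} (D : Digraph V) (S : Finset V) :
    ℕ :=
  sSup {p : ℕ | D.HasInternallyDisjointStrong S p}

theorem Digraph.isGreatest_localStrongConnectivity {V : Type*} [Fintype V] (D : Digraph V)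
    (S : Finset V) (hS : 2 ≤ S.card) :
    IsGreatest {p : ℕ | D.HasInternallyDisjointStrong S p} (D.localStrongConnectivity S) := by
  obtain ⟨x, hx, y, hy, hxy⟩ := Finset.one_lt_card.mp hS
  have hne : {p : ℕ | D.HasInternallyDisjointStrong S p}.Nonempty :=
    ⟨0, Fin.elim0, fun i => i.elim0, fun i => i.elim0⟩
  have hbdd : BddAbove {p : ℕ | D.HasInternallyDisjointStrong S p} := by
    refine ⟨Fintype.card V, ?_⟩
    rintro p ⟨H, h1, h2⟩
    -- the first arc of a walk from `x` to `y` differs for different subgraphs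
    have key : ∀ i, ∃ v, (H i).Adj x v := by
      intro i
      have hr := (h1 i).1.2 x ((h1 i).2 hx) y ((h1 i).2 hy)
      rcases Relation.ReflTransGen.cases_head hr with h | ⟨v, hv, _⟩
      · exact absurd h hxy
      · exact ⟨v, hv⟩
    choose g hg using key
    have hinj : Function.Injective g := by
      intro i j hij
      rcases lt_trichotomy i j with h | h | h
      · exact absurd ⟨hg i, hij ▸ hg j⟩ ((h2 i j h).2 x (g i))
      · exact h
      · exact absurd ⟨hg j, hij ▸ hg i⟩ ((h2 j i h).2 x (g j))
    simpa using Fintype.card_le_of_injective g hinj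
  exact ⟨Nat.sSup_mem hne hbdd, fun p hp => le_csSup hbdd hp⟩

/-- The strong subgraph `k`-connectivity `κ_k(D)`: the minimum of `κ_S(D)` over all `k`-subsets
`S` of the vertex set. It is meant for `2 ≤ k ≤ |V|`, where the minimum is over a nonempty set. -/
noncomputable def Digraph.strongConnectivity {V : Type*} (D : Digraph V) (k : ℕ) : ℕ :=
  sInf {m : ℕ | ∃ S : Finset V, S.card = k ∧ m = D.localStrongConnectivity S}

/-- The complete biorientation of a graph: every edge is replaced by the two opposite arcs. -/
def SimpleGraph.completeBiorientation {V : Type*} (G : SimpleGraph V) : Digraph V where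
  Adj u v := G.Adj u v

/-! ### Random access machines and polynomial time

The machine has registers `0, 1, 2, …`, addressed directly by the (finite) program, and memory
cells `0, 1, 2, …`, addressed indirectly through the content of a register; all of them hold
natural numbers. Every instruction costs one step. Addition and truncated subtraction are the only
arithmetic operations, so the number of bits of the largest number stored grows by at most one in
a step (constants of the program aside), and polynomial time on this machine is the same as
polynomial time on a Turing machine. -/

namespace RAM

/-- The instructions of the random access machine. -/
inductive Instr where
  /-- `reg r := c` -/
  | const (r c : ℕ)
  /-- `reg r := reg s + reg t` -/
  | add (r s t : ℕ)
  /-- `reg r := reg s - reg t`, which is `0` if `reg s < reg t` -/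
  | sub (r s t : ℕ)
  /-- `reg r := mem (reg s)` -/
  | load (r s : ℕ)
  /-- `mem (reg r) := reg s` -/
  | store (r s : ℕ)
  /-- continue at instruction number `l` -/
  | jump (l : ℕ)
  /-- continue at instruction number `l` if `reg r = 0`, and at the next instruction otherwise -/
  | jzero (r l : ℕ)

/-- A program is a finite list of instructions, numbered from `0`. -/
abbrev Program := List Instr

/-- A configuration of the machine: program counter, registers and memory. -/
structure Config where
  /-- the number of the instruction to be executed next -/
  pc : ℕ
  /-- the content of the registers -/
  reg : ℕ → ℕ
  /-- the content of the memory -/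
  mem : ℕ → ℕ

/-- The effect of a single instruction. -/
def Instr.exec : Instr → Config → Config
  | .const r c, ⟨pc, reg, mem⟩ => ⟨pc + 1, Function.update reg r c, mem⟩
  | .add r s t, ⟨pc, reg, mem⟩ => ⟨pc + 1, Function.update reg r (reg s + reg t), mem⟩
  | .sub r s t, ⟨pc, reg, mem⟩ => ⟨pc + 1, Function.update reg r (reg s - reg t), mem⟩
  | .load r s, ⟨pc, reg, mem⟩ => ⟨pc + 1, Function.update reg r (mem (reg s)), mem⟩
  | .store r s, ⟨pc, reg, mem⟩ => ⟨pc + 1, reg, Function.update mem (reg r) (reg s)⟩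
  | .jump l, ⟨_, reg, mem⟩ => ⟨l, reg, mem⟩
  | .jzero r l, ⟨pc, reg, mem⟩ => ⟨if reg r = 0 then l else pc + 1, reg, mem⟩

/-- The machine has halted when the program counter is not the number of an instruction. -/
def Halted (P : Program) (c : Config) : Prop :=
  P.length ≤ c.pc

/-- One step of the machine; a halted machine does not change any more. -/
def step (P : Program) (c : Config) : Config :=
  match P[c.pc]? with
  | some i => i.exec c
  | none => c

/-- The initial configuration on input `w`: the entries of `w` stand in the memory cells
`0, …, w.length - 1`, everything else is `0`. -/
def init (w : List ℕ) : Config where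
  pc := 0
  reg _ := 0
  mem i := w.getD i 0

/-- The size of an input: the total number of binary digits of its entries, plus one separator
for each of them. -/
def inputSize (w : List ℕ) : ℕ :=
  (w.map fun x => Nat.size x + 1).sum

/-- `f` is computable in polynomial time, where the inputs `a` are given by the words `enc a`:
there are one program and one polynomial such that on every input the program halts after at most
polynomially many steps in the size of the input, with the value of `f` in register `0`. -/
def PolyTimeComputable {α : Type*} (enc : α → List ℕ) (f : α → ℕ) : Prop :=
  ∃ (P : Program) (q : Polynomial ℕ), ∀ a : α, ∃ t ≤ q.eval (inputSize (enc a)),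
    Halted P ((step P)^[t] (init (enc a))) ∧ ((step P)^[t] (init (enc a))).reg 0 = f a

end RAM

/-! ### Finite graphs as inputs -/

/-- A finite graph on the vertices `0, …, n - 1`, with at least two vertices. -/
structure FiniteGraph where
  /-- the number of vertices -/
  n : ℕ
  two_le : 2 ≤ n
  /-- the graph itself -/
  graph : SimpleGraph (Fin n)

open Classical in
/-- The representation of a graph by its order, followed by the `n * n` entries of its adjacency
matrix, row by row: the entry number `i * n + j` is `1` if `i` and `j` are adjacent, else `0`. -/
noncomputable def FiniteGraph.encode (G : FiniteGraph) : List ℕ :=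
  G.n :: List.ofFn fun m : Fin (G.n * G.n) => if G.graph.Adj m.divNat m.modNat then 1 else 0

/-! Strong subgraphs that share exactly the vertices `x` and `y` are governed by a matching problem.
Give every vertex `u ∉ {x, y}` not adjacent to `y` a tail copy, every vertex `v ∉ {x, y}` not
adjacent to `x` a head copy, and join the tail copy of `u` to the head copy of `v` when `u = v` or
`u` and `v` are adjacent. Following a matching from a neighbour of `x`, one walks until a tail copy
is missing, which means that `y` is within reach, or unmatched. Distinct neighbours give disjoint
walks, since a vertex matched with itself lies on none of them, and together with `x` and `y` a walk
that does not end at an unmatched tail copy spans a strong subgraph. Hence `κ_{x,y}` is at least the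
degree of `x` minus the number of unmatched tail copies. Conversely, if the tail copies in `X` have
all their partners in `T`, then every strong subgraph leaves `X ∪ {x}` through an arc with its head
in `(N(x) ∪ T) \ X`, so `κ_{x,y} + |X| ≤ deg x + |T|`.

Both bounds meet at a maximum matching, which an auction finds: a tail copy takes a cheapest head
copy from its owner and thereby raises its price by one. Prices stop at the order `n` of the graph,
so their sum is at most `n ^ 2`, and every round with a bid increases it. In the end some price
level below `n` is unused, and the owners of the head copies above it want no head copy below it;
with the idle bidders as further elements of `X`, these head copies form the set `T`.

A program of nested loops of length `n` carries out the auction, and each of its constructs is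
compiled to machine code whose running time is bounded by a polynomial in `n`. -/

section StrongSubgraphs

variable {V : Type*} {D : Digraph V} {S : Finset V}

theorem exists_rel_of_reflTransGen {r : V → V → Prop} {U : Set V} {x y : V}
    (h : Relation.ReflTransGen r x y) (hx : x ∈ U) (hy : y ∉ U) : ∃ u ∈ U, ∃ v ∉ U, r u v := by
  induction h with
  | refl => exact absurd hx hy
  | @tail u v _ huv ih =>
    by_cases hu : u ∈ U
    · exact ⟨u, hu, v, hy, huv⟩
    · exact ih hu

/- The arc by which a strong subgraph leaves `U` ends in `K`, and disjoint subgraphs have different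
such heads: a common one would lie in `S`, and then both arcs would start at `x`. -/
theorem le_ncard_of_cut {U K : Set V} {x y : V} {p : ℕ} (hK : K.Finite) (hxS : x ∈ S)
    (hyS : y ∈ S) (hx : x ∈ U) (hy : y ∉ U)
    (hcut : ∀ u ∈ U, ∀ v ∉ U, D.Adj u v → v ∈ K ∧ (v ∈ S → u = x))
    (h : D.HasInternallyDisjointStrong S p) : p ≤ K.ncard := by
  obtain ⟨H, hH, hdisj⟩ := h
  have hleave (i : Fin p) : ∃ u ∈ U, ∃ v ∉ U, (H i).Adj u v :=
    exists_rel_of_reflTransGen ((hH i).1.2 x ((hH i).2 hxS) y ((hH i).2 hyS)) hx hy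
  choose tail htail head hhead harc using hleave
  have hhead_ne {i j : Fin p} (hij : i < j) : head i ≠ head j := by
    intro heq
    have hmem : head i ∈ (S : Set V) :=
      (hdisj i j hij).1 ▸ ⟨(H i).snd_mem (harc i), heq ▸ (H j).snd_mem (harc j)⟩
    have hi : tail i = x := (hcut _ (htail i) _ (hhead i) ((H i).adj_sub (harc i))).2 hmem
    have hj : tail j = x := (hcut _ (htail j) _ (hhead j) ((H j).adj_sub (harc j))).2 (heq ▸ hmem)
    exact (hdisj i j hij).2 x (head i) ⟨hi ▸ harc i, heq ▸ hj ▸ harc j⟩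
  have hinj : Function.Injective head := fun i j heq =>
    not_ne_iff.mp fun hne => hne.lt_or_gt.elim (hhead_ne · heq) (hhead_ne · heq.symm)
  simpa [Set.ncard_univ] using Set.ncard_le_ncard_of_injOn (s := Set.univ) head
    (fun i _ => (hcut _ (htail i) _ (hhead i) ((H i).adj_sub (harc i))).1) hinj.injOn hK

theorem hasInternallyDisjointStrong_ncard {ι : Type*} {I : Set ι} [Finite I]
    (H : ι → D.Subdigraph) (hH : ∀ a ∈ I, (H a).IsStrong ∧ (S : Set V) ⊆ (H a).verts)
    (hdisj : I.Pairwise fun a b =>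
      (H a).verts ∩ (H b).verts = S ∧ ∀ u v, ¬((H a).Adj u v ∧ (H b).Adj u v)) :
    D.HasInternallyDisjointStrong S I.ncard := by
  let e : Fin I.ncard ≃ I := (Finite.equivFin I).symm
  exact ⟨fun i => H (e i), fun i => hH _ (e i).2, fun i j hij =>
    hdisj (e i).2 (e j).2 fun h => hij.ne (e.injective (Subtype.ext h))⟩

theorem isGreatest_localStrongConnectivity_pair [Finite V] [DecidableEq V] (D : Digraph V)
    {x y : V} (hxy : x ≠ y) :
    IsGreatest {p | D.HasInternallyDisjointStrong {x, y} p} (D.localStrongConnectivity {x, y}) :=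
  have := Fintype.ofFinite V
  D.isGreatest_localStrongConnectivity _ (Finset.card_pair hxy).ge

end StrongSubgraphs

section Orbits

variable {V : Type*} {M : V → V → Prop} {a b : V}

/-- The vertices met when the successor relation `M` of a partial function is followed from `a`. -/
def orbit (M : V → V → Prop) (a : V) : Set V :=
  {v | Relation.ReflTransGen M a v}

theorem mem_orbit_self : a ∈ orbit M a :=
  .refl

theorem eq_or_rel_of_mem_orbit {v : V} (h : v ∈ orbit M a) : v = a ∨ ∃ u ∈ orbit M a, M u v :=
  Relation.ReflTransGen.cases_tail h

theorem disjoint_orbit (hM : Relator.LeftUnique M) (ha : ∀ u, ¬M u a) (hb : ∀ u, ¬M u b)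
    (hab : a ≠ b) : Disjoint (orbit M a) (orbit M b) := by
  refine Set.disjoint_left.mpr fun v hva hvb => ?_
  induction hva with
  | refl => exact (eq_or_rel_of_mem_orbit hvb).elim hab fun ⟨u, _, h⟩ => ha u h
  | tail _ hM_uv ih =>
    obtain rfl | ⟨w, hw, hM_wv⟩ := eq_or_rel_of_mem_orbit hvb
    · exact hb _ hM_uv
    · exact ih (hM hM_wv hM_uv ▸ hw)

theorem exists_terminal_mem_orbit [Finite V] (hM : Relator.LeftUnique M) (ha : ∀ u, ¬M u a) :
    ∃ t ∈ orbit M a, ∀ v, ¬M t v := by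
  by_contra! hsucc
  choose! next hnext using hsucc
  have hmaps : Set.MapsTo next (orbit M a) (orbit M a) := fun u hu => hu.tail (hnext u hu)
  have hinj : Set.InjOn next (orbit M a) := fun u hu v hv h => hM (hnext u hu) (h ▸ hnext v hv)
  obtain ⟨u, hu, hua⟩ := ((orbit M a).toFinite.injOn_iff_bijOn_of_mapsTo hmaps).mp hinj
    |>.surjOn mem_orbit_self
  exact ha u (hua ▸ hnext u hu)

end Orbits

section SplitGraph

variable {V : Type*} (G : SimpleGraph V) (x y : V)

/-- The vertices `u ∉ {x, y}` that have a tail copy in the split graph of `G` at `x` and `y`: those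
from which no edge leads directly to `y`. -/
def leftPart : Set V :=
  {u | u ≠ x ∧ u ≠ y ∧ ¬G.Adj u y}

/-- The vertices `v ∉ {x, y}` that have a head copy in the split graph of `G` at `x` and `y`: those
to which no edge leads directly from `x`. -/
def rightPart : Set V :=
  {v | v ≠ x ∧ v ≠ y ∧ ¬G.Adj x v}

/-- Adjacency of the tail copy of `u` and the head copy of `v` in the split graph. A matching of
the two parts describes a system of disjoint paths, in which the vertices off the paths are matched
to themselves. -/
def SplitAdj (u v : V) : Prop :=
  u = v ∨ G.Adj u v

/-- A matching in the split graph of `G` at `x` and `y`, where `M u v` means that the tail copy of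
`u` is matched to the head copy of `v`. -/
structure SplitMatching (M : V → V → Prop) : Prop where
  biUnique : Relator.BiUnique M
  mem_leftPart : ∀ {u v}, M u v → u ∈ leftPart G x y
  mem_rightPart : ∀ {u v}, M u v → v ∈ rightPart G x y
  splitAdj : ∀ {u v}, M u v → SplitAdj G u v

/-- The vertices whose tail copy is not covered by the matching `M`. -/
def unmatched (M : V → V → Prop) : Set V :=
  {u ∈ leftPart G x y | ∀ v, ¬M u v}

/-- The orbit of `a` under `M` has reached `y`. For `a = y` it stands for the edge `xy`. -/
def IsLinked (M : V → V → Prop) (a : V) : Prop :=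
  a = y ∨ ∃ b ∈ orbit M a, G.Adj b y

/-- The subgraph of the biorientation induced by `x`, `y` and the orbit of `a`, where the arcs
between `x` and `y` are left out unless `a = y`. -/
def orbitSubdigraph (M : V → V → Prop) (a : V) : G.completeBiorientation.Subdigraph where
  verts := {x, y} ∪ orbit M a
  Adj u v := G.Adj u v ∧ u ∈ {x, y} ∪ orbit M a ∧ v ∈ {x, y} ∪ orbit M a ∧
    (a = y ∨ ¬(u ∈ ({x, y} : Set V) ∧ v ∈ ({x, y} : Set V)))
  adj_sub h := h.1
  fst_mem h := h.2.1
  snd_mem h := h.2.2.1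

variable {G x y} {M : V → V → Prop} {a : V}

theorem orbitSubdigraph_adj_symm {u v : V} (h : (orbitSubdigraph G x y M a).Adj u v) :
    (orbitSubdigraph G x y M a).Adj v u :=
  ⟨h.1.symm, h.2.2.1, h.2.1, h.2.2.2.imp_right fun hn hvu => hn hvu.symm⟩

namespace SplitMatching

theorem not_rel_of_adj (hM : SplitMatching G x y M) (ha : G.Adj x a) (u : V) : ¬M u a :=
  fun h => (hM.mem_rightPart h).2.2 ha

theorem ne_of_mem_orbit (hM : SplitMatching G x y M) (ha : G.Adj x a) (hay : a ≠ y) {v : V}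
    (hv : v ∈ orbit M a) : v ≠ x ∧ v ≠ y := by
  obtain rfl | ⟨u, -, huv⟩ := eq_or_rel_of_mem_orbit hv
  · exact ⟨ha.ne', hay⟩
  · exact ⟨(hM.mem_rightPart huv).1, (hM.mem_rightPart huv).2.1⟩

theorem isStrong_orbitSubdigraph (hM : SplitMatching G x y M) (ha : G.Adj x a)
    (hlink : IsLinked G y M a) : (orbitSubdigraph G x y M a).IsStrong := by
  let H := orbitSubdigraph G x y M a
  have hx : x ∈ H.verts := .inl (.inl rfl)
  have hy : y ∈ H.verts := .inl (.inr rfl)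
  have hxa : H.Adj x a := by
    refine ⟨ha, hx, .inr mem_orbit_self, ?_⟩
    by_cases hay : a = y
    · exact .inl hay
    · exact .inr (by simp [hay, ha.ne'])
  have horbit : ∀ v ∈ orbit M a, Relation.ReflTransGen H.Adj x v := by
    intro v hv
    induction hv with
    | refl => exact .single hxa
    | @tail u v hu huv ih =>
      obtain rfl | hadj := hM.splitAdj huv
      · exact ih
      · have hv := hM.mem_rightPart huv
        exact ih.tail ⟨hadj, .inr hu, .inr (hu.tail huv), .inr (by simp [hv.1, hv.2.1])⟩
  have hxy : Relation.ReflTransGen H.Adj x y := by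
    by_cases hay : a = y
    · exact hay ▸ .single hxa
    · obtain ⟨b, hb, hby⟩ := hlink.resolve_left hay
      have hne := hM.ne_of_mem_orbit ha hay hb
      exact (horbit b hb).tail ⟨hby, .inr hb, hy, .inr (by simp [hne.1, hne.2])⟩
  have hreach : ∀ v ∈ H.verts, Relation.ReflTransGen H.Adj x v := by
    rintro v ((rfl | rfl) | hv)
    exacts [.refl, hxy, horbit v hv]
  have : Std.Symm H.Adj := ⟨fun _ _ => orbitSubdigraph_adj_symm⟩
  exact ⟨⟨x, hx⟩, fun u hu v hv =>
    (Relation.ReflTransGen.stdSymm.symm _ _ (hreach u hu)).trans (hreach v hv)⟩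

variable [Finite V]

theorem hasInternallyDisjointStrong [DecidableEq V] (hM : SplitMatching G x y M) :
    G.completeBiorientation.HasInternallyDisjointStrong {x, y}
      {a ∈ G.neighborSet x | IsLinked G y M a}.ncard := by
  refine hasInternallyDisjointStrong_ncard (orbitSubdigraph G x y M) (fun a ha =>
    ⟨hM.isStrong_orbitSubdigraph ha.1 ha.2, by simp [orbitSubdigraph]⟩) fun a ha b hb hab => ?_
  have hinter : (orbitSubdigraph G x y M a).verts ∩ (orbitSubdigraph G x y M b).verts = {x, y} := by
    have hdisj := disjoint_orbit hM.biUnique.1 (hM.not_rel_of_adj ha.1) (hM.not_rel_of_adj hb.1) hab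
    simp only [orbitSubdigraph, ← Set.union_inter_distrib_left, hdisj.inter_eq, Set.union_empty]
  refine ⟨by rw [hinter, Finset.coe_pair], fun u v ⟨hu, hv⟩ => ?_⟩
  have hends : u ∈ ({x, y} : Set V) ∧ v ∈ ({x, y} : Set V) :=
    hinter ▸ ⟨⟨hu.2.1, hv.2.1⟩, ⟨hu.2.2.1, hv.2.2.1⟩⟩
  exact hab ((hu.2.2.2.resolve_right (· hends)).trans (hv.2.2.2.resolve_right (· hends)).symm)

theorem exists_mem_unmatched (hM : SplitMatching G x y M) (ha : G.Adj x a)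
    (hlink : ¬IsLinked G y M a) : ∃ t ∈ orbit M a, t ∈ unmatched G x y M := by
  obtain ⟨t, ht, hterm⟩ := exists_terminal_mem_orbit hM.biUnique.1 (hM.not_rel_of_adj ha)
  have hne := hM.ne_of_mem_orbit ha (fun h => hlink (.inl h)) ht
  exact ⟨t, ht, ⟨hne.1, hne.2, fun h => hlink (.inr ⟨t, ht, h⟩)⟩, hterm⟩

theorem ncard_not_isLinked_le (hM : SplitMatching G x y M) :
    {a ∈ G.neighborSet x | ¬IsLinked G y M a}.ncard ≤ (unmatched G x y M).ncard := by
  choose! last hlast using fun a (h : a ∈ {a ∈ G.neighborSet x | ¬IsLinked G y M a}) =>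
    hM.exists_mem_unmatched h.1 h.2
  refine Set.ncard_le_ncard_of_injOn last (fun a ha => (hlast a ha).2) fun a ha b hb h => ?_
  by_contra hab
  exact (disjoint_orbit hM.biUnique.1 (hM.not_rel_of_adj ha.1) (hM.not_rel_of_adj hb.1)
    hab).ne_of_mem (hlast a ha).1 (hlast b hb).1 h

theorem ncard_neighborSet_le [DecidableEq V] (hM : SplitMatching G x y M) (hxy : x ≠ y) :
    (G.neighborSet x).ncard ≤
      G.completeBiorientation.localStrongConnectivity {x, y} + (unmatched G x y M).ncard := by
  calc (G.neighborSet x).ncard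
      = {a ∈ G.neighborSet x | IsLinked G y M a}.ncard +
          {a ∈ G.neighborSet x | ¬IsLinked G y M a}.ncard := by
        rw [← Set.ncard_union_eq (Set.disjoint_left.mpr fun a ha hn => hn.2 ha.2), ← Set.sep_or]
        simp only [em, and_true, Set.ofPred_mem_eq]
    _ ≤ _ := Nat.add_le_add ((isGreatest_localStrongConnectivity_pair _ hxy).2
        hM.hasInternallyDisjointStrong) hM.ncard_not_isLinked_le

end SplitMatching

theorem localStrongConnectivity_add_ncard_le [Finite V] [DecidableEq V] {X T : Set V} (hxy : x ≠ y)
    (hX : X ⊆ leftPart G x y) (hT : ∀ u ∈ X, ∀ v ∈ rightPart G x y, SplitAdj G u v → v ∈ T) :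
    G.completeBiorientation.localStrongConnectivity {x, y} + X.ncard ≤
      (G.neighborSet x).ncard + T.ncard := by
  have hmem {u v : V} (hu : u ∈ X) (huv : SplitAdj G u v) (hvx : v ≠ x) (hvy : v ≠ y) :
      v ∈ G.neighborSet x ∪ T := by
    by_cases hv : G.Adj x v
    · exact Or.inl hv
    · exact Or.inr (hT u hu v ⟨hvx, hvy, hv⟩ huv)
  have hXK : X ⊆ G.neighborSet x ∪ T := fun u hu => hmem hu (.inl rfl) (hX hu).1 (hX hu).2.1
  have hcut : ∀ u ∈ insert x X, ∀ v ∉ insert x X, G.Adj u v →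
      v ∈ (G.neighborSet x ∪ T) \ X ∧ (v ∈ ({x, y} : Finset V) → u = x) := by
    rintro u (rfl | hu) v hv huv
    · exact ⟨⟨.inl huv, fun h => hv (.inr h)⟩, fun _ => rfl⟩
    · have hvx : v ≠ x := fun h => hv (.inl h)
      have hvy : v ≠ y := fun h => (hX hu).2.2 (h ▸ huv)
      exact ⟨⟨hmem hu (.inr huv) hvx hvy, fun h => hv (.inr h)⟩, by simp [hvx, hvy]⟩
  have hyU : y ∉ insert x X := by
    rintro (h | h)
    exacts [hxy h.symm, (hX h).2.1 rfl]
  calc _ ≤ ((G.neighborSet x ∪ T) \ X).ncard + X.ncard :=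
        Nat.add_le_add_right (le_ncard_of_cut (Set.toFinite _) (by simp) (by simp)
          (Set.mem_insert x X) hyU hcut (isGreatest_localStrongConnectivity_pair _ hxy).1) _
    _ = (G.neighborSet x ∪ T).ncard := Set.ncard_sdiff_add_ncard_of_subset hXK
    _ ≤ _ := Set.ncard_union_le _ _

end SplitGraph

theorem le_strongConnectivity_two_iff {V : Type*} [DecidableEq V] [Nontrivial V] {D : Digraph V}
    {k : ℕ} : k ≤ D.strongConnectivity 2 ↔
      ∀ x y : V, x ≠ y → k ≤ D.localStrongConnectivity {x, y} := by
  have hne : {m | ∃ S : Finset V, S.card = 2 ∧ m = D.localStrongConnectivity S}.Nonempty :=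
    let ⟨x, y, hxy⟩ := exists_pair_ne V
    ⟨_, {x, y}, Finset.card_pair hxy, rfl⟩
  rw [Digraph.strongConnectivity, le_csInf_iff (OrderBot.bddBelow _) hne]
  refine ⟨fun h x y hxy => h _ ⟨_, Finset.card_pair hxy, rfl⟩, ?_⟩
  rintro h _ ⟨S, hS, rfl⟩
  obtain ⟨x, y, hxy, rfl⟩ := Finset.card_eq_two.mp hS
  exact h x y hxy

theorem strongConnectivity_two_le_card {V : Type*} [Finite V] [Nontrivial V] (G : SimpleGraph V) :
    G.completeBiorientation.strongConnectivity 2 ≤ Nat.card V := by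
  classical
  obtain ⟨x, y, hxy⟩ := exists_pair_ne V
  have hle := localStrongConnectivity_add_ncard_le (G := G) (X := ∅) (T := ∅) hxy
    (Set.empty_subset _) (by simp)
  rw [Set.ncard_empty, add_zero] at hle
  exact (le_strongConnectivity_two_iff.mp le_rfl x y hxy).trans (hle.trans (Set.ncard_le_card _))

/-- A stage of the auction that looks for a maximum matching of the split graph: the tail copies
bid for the head copies. -/
structure Auction (V : Type*) where
  /-- the price of a head copy -/
  price : V → ℕ
  /-- the vertex whose tail copy holds a head copy, if any -/
  owner : V → Option V

namespace Auction

variable {V : Type*} {G : SimpleGraph V} {x y u v : V} {A A' A'' : Auction V}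

/-- The relation matching a tail copy to the head copy it holds. -/
def Owns (A : Auction V) (u v : V) : Prop :=
  A.owner v = some u

/-- The bidders that hold nothing. -/
def idle (G : SimpleGraph V) (x y : V) (A : Auction V) : Set V :=
  unmatched G x y A.Owns

/-- The invariant of the auction. Prices are capped at the order of the graph, and the vertices
outside of the right part are priced out from the beginning; every owner has paid at most one more
than the price of any other head copy it could have chosen. -/
structure Valid (G : SimpleGraph V) (x y : V) (A : Auction V) : Prop where
  splitMatching : SplitMatching G x y A.Owns
  price_le : ∀ v, A.price v ≤ Nat.card V
  price_eq_card : ∀ {v}, v ∉ rightPart G x y → A.price v = Nat.card V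
  price_eq_zero : ∀ {v}, v ∈ rightPart G x y → A.owner v = none → A.price v = 0
  price_le_succ : ∀ {u v w}, A.Owns u v → SplitAdj G u w → A.price v ≤ A.price w + 1

/-- The vertex `u` makes no bid: it holds a head copy, or is not a bidder at all, or all head copies
it could hold have reached the maximal price. -/
def IsStuck (G : SimpleGraph V) (x y : V) (A : Auction V) (u : V) : Prop :=
  u ∈ A.idle G x y → ∀ v, SplitAdj G u v → Nat.card V ≤ A.price v

/-- The auction is over. -/
def Finished (G : SimpleGraph V) (x y : V) (A : Auction V) : Prop :=
  ∀ u, A.IsStuck G x y u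

theorem exists_unused_price [Finite V] (G : SimpleGraph V) (x y : V) (A : Auction V) :
    ∃ j < Nat.card V, ∀ v ∈ rightPart G x y, A.price v ≠ j := by
  have hlt : (A.price '' rightPart G x y).ncard < (Set.Iio (Nat.card V)).ncard :=
    calc _ ≤ (rightPart G x y).ncard := Set.ncard_image_le
      _ < (Set.univ : Set V).ncard :=
        Set.ncard_lt_ncard (Set.ssubset_univ_iff.mpr fun h => (h ▸ Set.mem_univ x).1 rfl)
      _ = _ := by simp [Set.ncard_univ, Set.ncard_eq_toFinset_card']
  obtain ⟨j, hj, hunused⟩ := Set.exists_mem_notMem_of_ncard_lt_ncard hlt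
  exact ⟨j, hj, fun v hv h => hunused ⟨v, hv, h⟩⟩

/- The head copies above an unused price level `j`, together with the idle bidders and the owners
of these copies, violate Hall's condition as much as the matching does. -/
theorem Valid.localStrongConnectivity_add_ncard_idle [Finite V] [DecidableEq V]
    (hA : A.Valid G x y) (hfin : A.Finished G x y) (hxy : x ≠ y) :
    G.completeBiorientation.localStrongConnectivity {x, y} + (A.idle G x y).ncard =
      (G.neighborSet x).ncard := by
  refine le_antisymm ?_ (hA.splitMatching.ncard_neighborSet_le hxy)
  obtain ⟨j, hj, hunused⟩ := A.exists_unused_price G x y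
  let T : Set V := {v ∈ rightPart G x y | j < A.price v}
  have howner : ∀ v ∈ T, ∃ u, A.Owns u v := fun v hv => Option.ne_none_iff_exists'.mp fun h =>
    hv.2.not_ge ((hA.price_eq_zero hv.1 h).le.trans j.zero_le)
  choose! buyer hbuyer using howner
  have hncard : (A.idle G x y ∪ buyer '' T).ncard = (A.idle G x y).ncard + T.ncard := by
    have hdisj : Disjoint (A.idle G x y) (buyer '' T) :=
      Set.disjoint_left.mpr fun _ hu ⟨v, hv, hvu⟩ => hu.2 v (hvu ▸ hbuyer v hv)
    have hinj : Set.InjOn buyer T := fun v hv w hw h =>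
      hA.splitMatching.biUnique.2 (hbuyer v hv) (h ▸ hbuyer w hw)
    rw [Set.ncard_union_eq hdisj, hinj.ncard_image]
  have hX : A.idle G x y ∪ buyer '' T ⊆ leftPart G x y := by
    rintro _ (hu | ⟨v, hv, rfl⟩)
    exacts [hu.1, hA.splitMatching.mem_leftPart (hbuyer v hv)]
  have hT : ∀ u ∈ A.idle G x y ∪ buyer '' T, ∀ v ∈ rightPart G x y, SplitAdj G u v → v ∈ T := by
    rintro _ (hu | ⟨w, hw, rfl⟩) v hv huv
    · exact ⟨hv, hj.trans_le (hfin _ hu v huv)⟩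
    · have hle : j < A.price v + 1 := hw.2.trans_le (hA.price_le_succ (hbuyer w hw) huv)
      exact ⟨hv, (Nat.lt_succ_iff.mp hle).lt_of_ne (hunused v hv).symm⟩
  have hcut := localStrongConnectivity_add_ncard_le hxy hX hT
  omega

open Classical in
/-- The auction before the first bid. -/
noncomputable def initial (G : SimpleGraph V) (x y : V) : Auction V where
  price v := if v ∈ rightPart G x y then 0 else Nat.card V
  owner _ := none

theorem valid_initial (G : SimpleGraph V) (x y : V) : (initial G x y).Valid G x y where
  splitMatching := by constructor <;> simp [initial, Owns, Relator.BiUnique, Relator.LeftUnique,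
    Relator.RightUnique]
  price_le v := by simp only [initial]; split_ifs <;> simp
  price_eq_card hv := if_neg hv
  price_eq_zero hv _ := if_pos hv
  price_le_succ h := by simp [initial, Owns] at h

section Bids

variable [DecidableEq V]

/-- The auction after a bid of `u` for `v`, which raises the price by one. -/
def bid (A : Auction V) (u v : V) : Auction V where
  price := Function.update A.price v (A.price v + 1)
  owner := Function.update A.owner v (some u)

theorem price_le_price_bid (A : Auction V) (u v w : V) : A.price w ≤ (A.bid u v).price w := by
  by_cases h : w = v <;> simp [bid, h]

theorem owns_bid {w t : V} : (A.bid u v).Owns w t ↔ t = v ∧ w = u ∨ t ≠ v ∧ A.Owns w t := by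
  by_cases h : t = v <;> simp [bid, Owns, h, eq_comm]

/-- `A'` arises from `A` when it is the turn of `u`: an idle bidder bids for a cheapest one of the
head copies it could hold. -/
def IsBid (G : SimpleGraph V) (x y u : V) (A A' : Auction V) : Prop :=
  (A.IsStuck G x y u ∧ A' = A) ∨ u ∈ A.idle G x y ∧ ∃ v, SplitAdj G u v ∧
    A.price v < Nat.card V ∧ (∀ w, SplitAdj G u w → A.price v ≤ A.price w) ∧ A' = A.bid u v

theorem splitMatching_bid (hA : SplitMatching G x y A.Owns) (hu : u ∈ A.idle G x y)
    (hv : v ∈ rightPart G x y) (huv : SplitAdj G u v) : SplitMatching G x y (A.bid u v).Owns where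
  biUnique := by
    refine ⟨fun _ _ _ h h' => Option.some_injective _ (h.symm.trans h'), fun w s t hs ht => ?_⟩
    obtain ⟨rfl, rfl⟩ | ⟨-, hs'⟩ := owns_bid.mp hs <;>
      obtain ⟨rfl, hw⟩ | ⟨-, ht'⟩ := owns_bid.mp ht
    · rfl
    · exact absurd ht' (hu.2 t)
    · exact absurd (hw ▸ hs') (hu.2 s)
    · exact hA.biUnique.2 hs' ht'
  mem_leftPart h := by
    obtain ⟨-, rfl⟩ | ⟨-, h⟩ := owns_bid.mp h
    exacts [hu.1, hA.mem_leftPart h]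
  mem_rightPart h := by
    obtain ⟨rfl, -⟩ | ⟨-, h⟩ := owns_bid.mp h
    exacts [hv, hA.mem_rightPart h]
  splitAdj h := by
    obtain ⟨rfl, rfl⟩ | ⟨-, h⟩ := owns_bid.mp h
    exacts [huv, hA.splitAdj h]

theorem Valid.bid (hA : A.Valid G x y) (hu : u ∈ A.idle G x y) (huv : SplitAdj G u v)
    (hlt : A.price v < Nat.card V) (hmin : ∀ w, SplitAdj G u w → A.price v ≤ A.price w) :
    (A.bid u v).Valid G x y := by
  have hv : v ∈ rightPart G x y := by_contra fun h => hlt.ne (hA.price_eq_card h)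
  refine ⟨splitMatching_bid hA.splitMatching hu hv huv, fun w => ?_, fun {w} hw => ?_,
    fun {w} hw hnone => ?_, fun {a b w} h haw => ?_⟩
  · by_cases hw : w = v
    · simpa [Auction.bid, hw] using hlt
    · simpa [Auction.bid, hw] using hA.price_le w
  · have hwv : w ≠ v := fun h => hw (h ▸ hv)
    simpa [Auction.bid, hwv] using hA.price_eq_card hw
  · have hwv : w ≠ v := by
      rintro rfl
      simp [Auction.bid] at hnone
    simp only [Auction.bid, Function.update_of_ne hwv] at hnone ⊢
    exact hA.price_eq_zero hw hnone
  · refine le_trans ?_ (Nat.succ_le_succ (A.price_le_price_bid u v w))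
    rcases owns_bid.mp h with ⟨rfl, rfl⟩ | ⟨hb, h⟩
    · simpa [Auction.bid] using hmin w haw
    · simpa [Auction.bid, hb] using hA.price_le_succ h haw

theorem Valid.of_isBid (hA : A.Valid G x y) (h : IsBid G x y u A A') : A'.Valid G x y := by
  obtain ⟨-, rfl⟩ | ⟨hu, v, huv, hlt, hmin, rfl⟩ := h
  exacts [hA, hA.bid hu huv hlt hmin]

end Bids

section Potential

variable [Fintype V]

/-- The sum of the prices, which measures the progress of the auction. -/
def potential (A : Auction V) : ℕ :=
  ∑ v, A.price v

theorem Valid.finished_of_le_potential (hA : A.Valid G x y)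
    (h : Nat.card V * Nat.card V ≤ A.potential) : A.Finished G x y := by
  have hsum : ∑ v, A.price v = ∑ _v : V, Nat.card V :=
    le_antisymm (Finset.sum_le_sum fun v _ => hA.price_le v) (by simpa [potential] using h)
  exact fun _ _ v _ => ((Finset.sum_eq_sum_iff_of_le fun v _ => hA.price_le v).mp hsum v
    (Finset.mem_univ v)).ge

theorem potential_bid [DecidableEq V] (A : Auction V) (u v : V) :
    (A.bid u v).potential = A.potential + 1 := by
  simp only [potential, bid, Finset.sum_update_of_mem (Finset.mem_univ v)]
  rw [← Finset.add_sum_erase _ _ (Finset.mem_univ v), Finset.sdiff_singleton_eq_erase]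
  ring

/-- `A'` arises from `A` when each element of `U` has had a turn: either nobody could bid, or the
potential has grown. -/
def Round (G : SimpleGraph V) (x y : V) (U : Set V) (A A' : Auction V) : Prop :=
  (∀ u ∈ U, A.IsStuck G x y u) ∧ A' = A ∨ ¬A.Finished G x y ∧ A.potential < A'.potential

theorem Round.insert [DecidableEq V] {U : Set V} (h : Round G x y U A A')
    (h' : IsBid G x y u A' A'') : Round G x y (insert u U) A A'' := by
  obtain ⟨hstuck, rfl⟩ | ⟨hidle, v, huv, hlt, -, rfl⟩ := h'
  · refine h.imp_left fun ⟨hU, hA⟩ => ⟨?_, hA⟩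
    rintro w (rfl | hw)
    exacts [hA ▸ hstuck, hU w hw]
  · refine .inr ?_
    rw [potential_bid]
    obtain ⟨-, rfl⟩ | ⟨hfin, hpot⟩ := h
    · exact ⟨fun hfin => hlt.not_ge (hfin u hidle v huv), Nat.lt_succ_self _⟩
    · exact ⟨hfin, hpot.trans (Nat.lt_succ_self _)⟩

/-- `A'` arises from `A` by `k` rounds of bids, and possibly more: unless the auction is over, each
of them has increased the potential. -/
def Rounds (G : SimpleGraph V) (x y : V) (k : ℕ) (A A' : Auction V) : Prop :=
  (A.Finished G x y → A' = A) ∧ (A'.Finished G x y ∨ A.potential + k ≤ A'.potential)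

theorem Round.rounds_one (h : Round G x y Set.univ A A') : Rounds G x y 1 A A' := by
  obtain ⟨hfin, rfl⟩ | ⟨hfin, hlt⟩ := h
  · exact ⟨fun _ => rfl, .inl fun u => hfin u (Set.mem_univ u)⟩
  · exact ⟨fun h => absurd h hfin, .inr hlt⟩

theorem Rounds.trans {k l : ℕ} (h : Rounds G x y k A A') (h' : Rounds G x y l A' A'') :
    Rounds G x y (k + l) A A'' := by
  refine ⟨fun hA => ?_, ?_⟩
  · obtain rfl := h.1 hA
    exact h'.1 hA
  · obtain hfin | hle := h.2
    · exact .inl (h'.1 hfin ▸ hfin)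
    · exact h'.2.imp_right fun hle' => by omega

theorem Valid.finished_of_rounds (hA' : A'.Valid G x y)
    (h : Rounds G x y (Nat.card V * Nat.card V) A A') : A'.Finished G x y :=
  h.2.elim id fun hle => hA'.finished_of_le_potential (le_of_add_le_right hle)

end Potential

end Auction

namespace RAM

section Language

/-- Arithmetic expressions over program variables, for programs on a graph: besides addition and
truncated subtraction there is multiplication by the order of the graph. -/
inductive Expr (ι : Type*) where
  /-- a constant -/
  | lit (k : ℕ)
  /-- the value of a variable -/
  | var (i : ι)
  /-- a sum -/
  | add (a b : Expr ι)
  /-- a truncated difference -/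
  | sub (a b : Expr ι)
  /-- the order times the value of an expression -/
  | scale (a : Expr ι)
  /-- the content of the memory cell with the given address -/
  | get (a : Expr ι)

/-- Programs with bounded loops. -/
inductive Cmd (ι : Type*) where
  /-- assign the value of `e` to the variable `i` -/
  | assign (i : ι) (e : Expr ι)
  /-- write the value of `e` into the memory cell with address `a` -/
  | put (a e : Expr ι)
  /-- run one program after the other -/
  | seq (c d : Cmd ι)
  /-- run a program if the value of `e` is positive -/
  | ifPos (e : Expr ι) (c : Cmd ι)
  /-- run `c` for the values `n - 1, …, 0` of `i`, where `n` is the order of the graph -/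
  | loop (i : ι) (c : Cmd ι)

/-- The values of the variables and the content of the memory. -/
structure State (ι : Type*) where
  /-- the values of the variables -/
  var : ι → ℕ
  /-- the content of the memory -/
  mem : ℕ → ℕ

variable {ι : Type*} (n : ℕ)

/-- The value of an expression, for a graph of order `n`. -/
def Expr.eval (s : State ι) : Expr ι → ℕ
  | lit k => k
  | var i => s.var i
  | add a b => a.eval s + b.eval s
  | sub a b => a.eval s - b.eval s
  | scale a => n * a.eval s
  | get a => s.mem (a.eval s)

variable [DecidableEq ι]

/-- The state after an assignment. -/
def State.set (s : State ι) (i : ι) (k : ℕ) : State ι :=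
  { s with var := Function.update s.var i k }

/-- The state after a memory cell has been overwritten. -/
def State.put (s : State ι) (a k : ℕ) : State ι :=
  { s with mem := Function.update s.mem a k }

/-- The effect of a program, for a graph of order `n`. -/
def Cmd.eval : Cmd ι → State ι → State ι
  | assign i e, s => s.set i (e.eval n s)
  | put a e, s => s.put (a.eval n s) (e.eval n s)
  | seq c d, s => d.eval (c.eval s)
  | ifPos e c, s => if 0 < e.eval n s then c.eval s else s
  | loop i c, s => (List.range n).foldr (fun k s => c.eval (s.set i k)) s

theorem foldr_range_induction {α : Type*} {f : ℕ → α → α} (I : ℕ → α → Prop) {k : ℕ} {s : α}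
    (h0 : I k s) (hstep : ∀ i < k, ∀ s, I (i + 1) s → I i (f i s)) :
    I 0 ((List.range k).foldr f s) := by
  induction k generalizing s with
  | zero => exact h0
  | succ k ih =>
    rw [List.range_succ, List.foldr_append]
    exact ih (hstep k k.lt_succ_self s h0) fun i hi => hstep i (hi.trans k.lt_succ_self)

end Language

section Machine

variable {P : Program} {a b o : ℕ} {m m' m'' : Config} {Q R : Config → Prop}

/-- The code `l` stands in the program `P` from instruction number `o` on. -/
def CodeAt (P : Program) : ℕ → Program → Prop
  | _, [] => True
  | o, i :: l => P[o]? = some i ∧ CodeAt P (o + 1) l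

theorem codeAt_append {l l' : Program} :
    CodeAt P o (l ++ l') ↔ CodeAt P o l ∧ CodeAt P (o + l.length) l' := by
  induction l generalizing o with
  | nil => simp [CodeAt]
  | cons i l ih => simp [CodeAt, ih, and_assoc, add_assoc, add_comm 1]

theorem codeAt_self (P l : Program) : CodeAt (l ++ P) l.length P := by
  induction P generalizing l with
  | nil => trivial
  | cons i P ih => exact ⟨by simp, by simpa using ih (l ++ [i])⟩

/-- From the configuration `m`, the program reaches within `b` steps a configuration with `Q`. -/
def Reaches (P : Program) (b : ℕ) (m : Config) (Q : Config → Prop) : Prop :=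
  ∃ t ≤ b, Q ((step P)^[t] m)

namespace Reaches

theorem here (h : Q m) : Reaches P b m Q :=
  ⟨0, b.zero_le, h⟩

theorem step {i : Instr} (hi : P[m.pc]? = some i) (h : Reaches P b (i.exec m) Q) :
    Reaches P (b + 1) m Q := by
  obtain ⟨t, ht, hQ⟩ := h
  refine ⟨t + 1, Nat.succ_le_succ ht, ?_⟩
  rwa [Function.iterate_succ_apply, RAM.step, hi]

theorem bind (h : Reaches P a m Q) (h' : ∀ m', Q m' → Reaches P b m' R) :
    Reaches P (a + b) m R := by
  obtain ⟨t, ht, hQ⟩ := h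
  obtain ⟨t', ht', hR⟩ := h' _ hQ
  exact ⟨t + t', add_le_add ht ht', by rwa [add_comm, Function.iterate_add_apply]⟩

theorem mono (h : Reaches P a m Q) (hab : a ≤ b) (hQR : ∀ m', Q m' → R m') : Reaches P b m R :=
  let ⟨t, ht, hQ⟩ := h
  ⟨t, ht.trans hab, hQR _ hQ⟩

end Reaches

/-- The configurations `m` and `m'` have the same memory and the same registers below `t`. -/
structure Agree (t : ℕ) (m m' : Config) : Prop where
  reg : ∀ r < t, m'.reg r = m.reg r
  mem : m'.mem = m.mem

theorem Agree.trans {t : ℕ} (h : Agree t m m') (h' : Agree t m' m'') : Agree t m m'' :=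
  ⟨fun r hr => (h'.reg r hr).trans (h.reg r hr), h'.mem.trans h.mem⟩

theorem Agree.mono {s t : ℕ} (h : Agree t m m') (hst : s ≤ t) : Agree s m m' :=
  ⟨fun r hr => h.reg r (hr.trans_le hst), h.mem⟩

/-- Code that runs `body` once for each of the values `k - 1, …, 0` of register `t`, where `k` is
the content of register `r`. Register `t + 1` is used as well. -/
def counted (r t o : ℕ) (body : Program) : Program :=
  [.const t 0, .add t t r, .jzero t (o + 6 + body.length), .const (t + 1) 1, .sub t t (t + 1)] ++
    body ++ [.jump (o + 2)]

end Machine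

section Counted

variable {P : Program} {m : Config} {r t o b k : ℕ} {body : Program} {J : ℕ → Config → Prop}

theorem codeAt_of_counted (hcode : CodeAt P o (counted r t o body)) : CodeAt P (o + 5) body :=
  (codeAt_append.mp (codeAt_append.mp hcode).1).2

theorem reaches_counted_from_test (hcode : CodeAt P o (counted r t o body))
    (hJ : ∀ {i m m'}, J i m → Agree t m m' → J i m')
    (hbody : ∀ i < k, ∀ m : Config, m.pc = o + 5 → m.reg t = i → J (i + 1) m →
      Reaches P b m fun m' => m'.pc = o + 5 + body.length ∧ m'.reg t = i ∧ J i m')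
    (hpc : m.pc = o + 2) (hk : m.reg t = k) (h : J k m) :
    Reaches P (k * (b + 4) + 1) m fun m' => m'.pc = o + 6 + body.length ∧ J 0 m' := by
  obtain ⟨hcode', hjump, -⟩ := codeAt_append.mp hcode
  rw [List.length_append, ← add_assoc] at hjump
  obtain ⟨⟨-, -, hjzero, hconst, hsub, -⟩, -⟩ := codeAt_append.mp hcode'
  induction k generalizing m with
  | zero =>
    obtain ⟨pc, reg, mem⟩ := m
    obtain rfl := hpc
    exact (Reaches.here ⟨if_pos hk, hJ h ⟨fun _ _ => rfl, rfl⟩⟩).step hjzero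
  | succ k ih =>
    obtain ⟨pc, reg, mem⟩ := m
    obtain rfl := hpc
    let m₁ : Config := ⟨o + 5, Function.update (Function.update reg (t + 1) 1) t k, mem⟩
    have htest : Reaches P 3 ⟨o + 2, reg, mem⟩ (· = m₁) := by
      refine Reaches.step (b := 2) hjzero ?_
      have hne : reg t ≠ 0 := hk.trans_ne k.succ_ne_zero
      simp only [Instr.exec, hne, if_false]
      exact ((Reaches.here (b := 0) (by simp_all [Instr.exec, m₁])).step hsub).step hconst
    have hm₁ : Agree t ⟨o + 2, reg, mem⟩ m₁ :=
      ⟨fun q hq => by simp [m₁, hq.ne, (hq.trans t.lt_succ_self).ne], rfl⟩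
    have hround : Reaches P (b + 1) m₁ fun m' => m'.pc = o + 2 ∧ m'.reg t = k ∧ J k m' := by
      refine (hbody k k.lt_succ_self m₁ rfl (by simp [m₁]) (hJ h hm₁)).bind ?_
      rintro ⟨pc, reg, mem⟩ ⟨rfl, hk, h⟩
      exact Reaches.step hjump (Reaches.here ⟨rfl, hk, hJ h ⟨fun _ _ => rfl, rfl⟩⟩)
    refine (htest.bind fun m' hm' => hm' ▸ hround.bind fun m₂ ⟨hpc, hk, hJ₂⟩ =>
      ih (fun i hi => hbody i (hi.trans k.lt_succ_self)) hpc hk hJ₂).mono ?_ fun _ => id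
    linarith

theorem reaches_counted (hcode : CodeAt P o (counted r t o body)) (hr : r < t)
    (hJ : ∀ {i m m'}, J i m → Agree t m m' → J i m')
    (hbody : ∀ i < k, ∀ m : Config, m.pc = o + 5 → m.reg t = i → J (i + 1) m →
      Reaches P b m fun m' => m'.pc = o + 5 + body.length ∧ m'.reg t = i ∧ J i m')
    (hpc : m.pc = o) (hk : m.reg r = k) (h : J k m) :
    Reaches P (k * (b + 4) + 3) m fun m' => m'.pc = o + 6 + body.length ∧ J 0 m' := by
  obtain ⟨⟨hconst, hadd, -⟩, -⟩ := codeAt_append.mp (codeAt_append.mp hcode).1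
  obtain ⟨pc, reg, mem⟩ := m
  obtain rfl := hpc
  refine Reaches.step (b := k * (b + 4) + 2) hconst (Reaches.step hadd ?_)
  refine reaches_counted_from_test hcode hJ hbody rfl ?_ (hJ h ⟨fun q hq => ?_, rfl⟩)
  · simpa [Instr.exec, hr.ne] using hk
  · simp [Instr.exec, hq.ne]

end Counted

section Compiler

open Polynomial

variable {ι : Type*} (ρ : Option ι → ℕ)

/-- Machine code evaluating an expression. It is to be placed at instruction number `o`, leaves the
value in register `t` and uses no registers below `t` for other intermediate results. The value of
the variable `i` is expected in register `ρ (some i)`, the order of the graph in `ρ none`. -/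
def Expr.compile : Expr ι → (t o : ℕ) → Program
  | lit k, t, _ => [.const t k]
  | var i, t, _ => [.const t 0, .add t t (ρ (some i))]
  | add a b, t, o =>
    a.compile t o ++ b.compile (t + 1) (o + (a.compile t o).length) ++ [.add t t (t + 1)]
  | sub a b, t, o =>
    a.compile t o ++ b.compile (t + 1) (o + (a.compile t o).length) ++ [.sub t t (t + 1)]
  | scale a, t, o =>
    .const t 0 :: (a.compile (t + 1) (o + 1) ++
      counted (ρ none) (t + 2) (o + 1 + (a.compile (t + 1) (o + 1)).length) [.add t t (t + 1)])
  | get a, t, o => a.compile t o ++ [.load t t]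

/-- A bound for the running time of the code of an expression in terms of the order. -/
noncomputable def Expr.cost : Expr ι → ℕ[X]
  | lit _ => 1
  | var _ => 2
  | add a b => a.cost + b.cost + 1
  | sub a b => a.cost + b.cost + 1
  | scale a => a.cost + (X * 5 + 3) + 1
  | get a => a.cost + 1

/-- Machine code for a program, to be placed at instruction number `o` and using only registers from
`t` on besides those of the variables. -/
def Cmd.compile : Cmd ι → (t o : ℕ) → Program
  | assign i e, t, o =>
    e.compile ρ t o ++ [.const (ρ (some i)) 0, .add (ρ (some i)) (ρ (some i)) t]
  | put a e, t, o =>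
    a.compile ρ t o ++ e.compile ρ (t + 1) (o + (a.compile ρ t o).length) ++ [.store t (t + 1)]
  | seq c d, t, o => c.compile t o ++ d.compile t (o + (c.compile t o).length)
  | ifPos e c, t, o =>
    let start := o + (e.compile ρ t o).length + 1
    e.compile ρ t o ++ .jzero t (start + (c.compile t start).length) :: c.compile t start
  | loop i c, t, o =>
    counted (ρ none) t o
      (.const (ρ (some i)) 0 :: .add (ρ (some i)) (ρ (some i)) t :: c.compile (t + 1) (o + 7))

/-- A bound for the running time of the code of a program in terms of the order. -/
noncomputable def Cmd.cost : Cmd ι → ℕ[X]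
  | assign _ e => e.cost + 2
  | put a e => a.cost + e.cost + 1
  | seq c d => c.cost + d.cost
  | ifPos e c => e.cost + (c.cost + 1)
  | loop _ c => X * (c.cost + 2 + 4) + 3

/-- The machine configuration `m` stores the order `n` and the state `s`. -/
structure Represents (n : ℕ) (s : State ι) (m : Config) : Prop where
  order : m.reg (ρ none) = n
  var : ∀ i, m.reg (ρ (some i)) = s.var i
  mem : m.mem = s.mem

variable {ρ} {n t o : ℕ} {s : State ι} {m m' : Config} {P : Program}

theorem Represents.of_agree (h : Represents ρ n s m) (ht : ∀ i, ρ i < t) (h' : Agree t m m') :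
    Represents ρ n s m' :=
  ⟨(h'.reg _ (ht _)).trans h.order, fun i => (h'.reg _ (ht _)).trans (h.var i), h'.mem.trans h.mem⟩

/-- Within `b` steps from `m`, the program computes the value `v` into register `t`, arriving at
instruction number `o`. -/
def Yields (P : Program) (b t : ℕ) (m : Config) (o v : ℕ) : Prop :=
  Reaches P b m fun m' => m'.pc = o ∧ m'.reg t = v ∧ Agree t m m'

theorem Yields.two {a b t o o' v w : ℕ} (h : Yields P a t m o v)
    (h' : ∀ m', m'.pc = o → Agree t m m' → Yields P b (t + 1) m' o' w) :
    Reaches P (a + b) m fun m' =>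
      m'.pc = o' ∧ m'.reg t = v ∧ m'.reg (t + 1) = w ∧ Agree t m m' :=
  Reaches.bind h fun m' ⟨hpc, hv, hagree⟩ => (h' m' hpc hagree).mono le_rfl
    fun _ ⟨hpc', hw, hagree'⟩ => ⟨hpc', (hagree'.reg t t.lt_succ_self).trans hv, hw,
      hagree.trans (hagree'.mono t.le_succ)⟩

theorem yields_scale {v : ℕ} (hcode : CodeAt P o (counted (ρ none) (t + 2) o [.add t t (t + 1)]))
    (ht : ρ none < t) (hpc : m.pc = o) (hn : m.reg (ρ none) = n) (h0 : m.reg t = 0)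
    (hv : m.reg (t + 1) = v) : Yields P (n * 5 + 3) t m (o + 7) (n * v) := by
  let J (i : ℕ) (m' : Config) : Prop :=
    m'.reg (t + 1) = v ∧ m'.reg t + i * v = n * v ∧ Agree t m m'
  have hJ {i : ℕ} {m₁ m₂ : Config} (h : J i m₁) (h' : Agree (t + 2) m₁ m₂) : J i m₂ :=
    ⟨(h'.reg _ (by simp)).trans h.1, by rw [h'.reg t (by simp), h.2.1],
      h.2.2.trans (h'.mono (by simp))⟩
  have hinit : J n m := ⟨hv, by rw [h0, zero_add], fun _ _ => rfl, rfl⟩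
  refine (reaches_counted (J := J) hcode (ht.trans (by simp)) hJ (fun i _ m₁ hpc₁ hi h => ?_)
    hpc hn hinit).mono le_rfl fun m' h => ⟨h.1, by simpa using h.2.2.1, h.2.2.2⟩
  obtain ⟨hadd, -⟩ := codeAt_of_counted hcode
  obtain ⟨pc, reg, mem⟩ := m₁
  obtain rfl := hpc₁
  refine (Reaches.here (b := 0) ⟨rfl, ?_, ?_, ?_, h.2.2.trans ⟨fun q hq => ?_, rfl⟩⟩).step hadd
  · simpa [Instr.exec] using hi
  · simpa [Instr.exec] using h.1
  · have h₁ : reg (t + 1) = v := h.1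
    have h₂ : reg t + (i + 1) * v = n * v := h.2.1
    simp only [Instr.exec, Function.update_self]
    linarith
  · simp [Instr.exec, hq.ne]

theorem Expr.yields_compile_scale (a : Expr ι) (ht : ∀ i, ρ i < t)
    (hcode : CodeAt P o (a.scale.compile ρ t o))
    (ha : ∀ {o m}, CodeAt P o (a.compile ρ (t + 1) o) → m.pc = o → Represents ρ n s m →
      Yields P (a.cost.eval n) (t + 1) m (o + (a.compile ρ (t + 1) o).length) (a.eval n s))
    (hpc : m.pc = o) (hs : Represents ρ n s m) :
    Yields P (a.scale.cost.eval n) t m (o + (a.scale.compile ρ t o).length)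
      (a.scale.eval n s) := by
  obtain ⟨hconst, hcode⟩ := hcode
  obtain ⟨hcode_a, hscale⟩ := codeAt_append.mp hcode
  obtain ⟨pc, reg, mem⟩ := m
  obtain rfl := hpc
  have hm₁ : Agree t ⟨pc, reg, mem⟩ ⟨pc + 1, Function.update reg t 0, mem⟩ :=
    ⟨fun q hq => Function.update_of_ne hq.ne _ _, rfl⟩
  have hs₁ := hs.of_agree ht hm₁
  simp only [cost, eval_add, eval_one, eval_mul, eval_X, eval_ofNat]
  refine Reaches.step hconst (Reaches.bind (ha hcode_a rfl hs₁) fun m₂ ⟨hpc, hv, hm₂⟩ => ?_)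
  have h0 : m₂.reg t = 0 := (hm₂.reg t t.lt_succ_self).trans (Function.update_self _ _ _)
  have hs₂ := hs₁.of_agree ht (hm₂.mono t.le_succ)
  refine (yields_scale hscale (ht none) hpc hs₂.order h0 hv).mono le_rfl
    fun m' ⟨hpc', hv', hm'⟩ => ⟨?_, hv', (hm₁.trans (hm₂.mono t.le_succ)).trans hm'⟩
  simpa [compile, counted, add_assoc, add_comm 1] using hpc'

theorem Expr.yields_compile (e : Expr ι) (ht : ∀ i, ρ i < t)
    (hcode : CodeAt P o (e.compile ρ t o)) (hpc : m.pc = o) (hs : Represents ρ n s m) :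
    Yields P (e.cost.eval n) t m (o + (e.compile ρ t o).length) (e.eval n s) := by
  induction e generalizing t o m with
  | lit k =>
    obtain ⟨pc, reg, mem⟩ := m
    obtain rfl := hpc
    rw [cost, eval_one]
    refine (Reaches.here (b := 0) ⟨rfl, ?_, fun q hq => ?_, rfl⟩).step hcode.1
    · simp [Instr.exec, eval]
    · simp [Instr.exec, hq.ne]
  | var i =>
    obtain ⟨pc, reg, mem⟩ := m
    obtain rfl := hpc
    rw [cost, eval_ofNat]
    refine ((Reaches.here (b := 0) ⟨rfl, ?_, fun q hq => ?_, rfl⟩).step hcode.2.1).step hcode.1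
    · simp [Instr.exec, eval, ← hs.var i, (ht i).ne]
    · simp [Instr.exec, hq.ne]
  | add a b iha ihb | sub a b iha ihb =>
    obtain ⟨hab, hop, -⟩ := codeAt_append.mp hcode
    obtain ⟨ha, hb⟩ := codeAt_append.mp hab
    rw [cost, eval_add, eval_add, eval_one]
    refine ((iha ht ha hpc hs).two fun m' hpc' hagree =>
      ihb (fun i => (ht i).trans t.lt_succ_self) hb hpc' (hs.of_agree ht hagree)).bind ?_
    rintro ⟨pc, reg, mem⟩ ⟨rfl, hva, hvb, hagree⟩
    rw [List.length_append, ← add_assoc] at hop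
    refine (Reaches.here (b := 0) ⟨?_, ?_, hagree.trans ⟨fun q hq => ?_, rfl⟩⟩).step hop
    · simp [Instr.exec, compile, add_assoc]
    · simp_all [Instr.exec, eval]
    · simp [Instr.exec, hq.ne]
  | scale a ih =>
    exact yields_compile_scale a ht hcode (fun hcode hpc hs =>
      ih (fun i => (ht i).trans t.lt_succ_self) hcode hpc hs) hpc hs
  | get a ih =>
    obtain ⟨ha, hload, -⟩ := codeAt_append.mp hcode
    rw [cost, eval_add, eval_one]
    refine Reaches.bind (ih ht ha hpc hs) ?_
    rintro ⟨pc, reg, mem⟩ ⟨rfl, hv, hagree⟩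
    refine (Reaches.here (b := 0) ⟨?_, ?_, hagree.trans ⟨fun q hq => ?_, rfl⟩⟩).step hload
    · simp [Instr.exec, compile, add_assoc]
    · have hmem : mem = s.mem := hagree.mem.trans hs.mem
      simp_all [Instr.exec, eval]
    · simp [Instr.exec, hq.ne]

end Compiler

section Simulation

open Polynomial

variable {ι : Type*} {ρ : Option ι → ℕ} {P : Program} {a b n t o o' v : ℕ} {s s' : State ι}
  {m m' : Config}

variable (ρ) in
/-- Within `b` steps from `m`, the program arrives at instruction number `o` with the state `s`,
having changed no other registers below `t`. -/
def Simulates (P : Program) (b t : ℕ) (m : Config) (o n : ℕ) (s : State ι) : Prop :=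
  Reaches P b m fun m' =>
    m'.pc = o ∧ Represents ρ n s m' ∧ ∀ r < t, r ∉ Set.range ρ → m'.reg r = m.reg r

theorem Simulates.bind (h : Simulates ρ P a t m o n s)
    (h' : ∀ m', m'.pc = o → Represents ρ n s m' → Simulates ρ P b t m' o' n s') :
    Simulates ρ P (a + b) t m o' n s' :=
  Reaches.bind h fun m' ⟨hpc, hs, hreg⟩ => (h' m' hpc hs).mono le_rfl fun _ ⟨hpc', hs', hreg'⟩ =>
    ⟨hpc', hs', fun r hr hr' => (hreg' r hr hr').trans (hreg r hr hr')⟩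

theorem Yields.bind_simulates (h : Yields P a t m o v)
    (h' : ∀ m', m'.pc = o → m'.reg t = v → Agree t m m' → Simulates ρ P b t m' o' n s') :
    Simulates ρ P (a + b) t m o' n s' :=
  Reaches.bind h fun m' ⟨hpc, hv, hagree⟩ => (h' m' hpc hv hagree).mono le_rfl
    fun _ ⟨hpc', hs', hreg'⟩ =>
      ⟨hpc', hs', fun r hr hr' => (hreg' r hr hr').trans (hagree.reg r hr)⟩

variable [DecidableEq ι]

theorem simulates_set {q : ℕ} (i : ι) (hρ : ρ.Injective) (hq : ρ (some i) < q)
    (hcode : CodeAt P o [.const (ρ (some i)) 0, .add (ρ (some i)) (ρ (some i)) q])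
    (hpc : m.pc = o) (hs : Represents ρ n s m) (hv : m.reg q = v) :
    Simulates ρ P 2 t m (o + 2) n (s.set i v) := by
  obtain ⟨hconst, hadd, -⟩ := hcode
  obtain ⟨pc, reg, mem⟩ := m
  obtain rfl := hpc
  refine Reaches.step (b := 1) hconst (Reaches.step (b := 0) hadd (Reaches.here
    ⟨rfl, ⟨?_, fun j => ?_, hs.mem⟩, fun r _ hr' => ?_⟩))
  · simpa [Instr.exec, hρ.eq_iff] using hs.order
  · rcases eq_or_ne j i with rfl | hj
    · simpa [Instr.exec, State.set, hq.ne'] using hv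
    · simpa [Instr.exec, State.set, hρ.eq_iff, hj] using hs.var j
  · have hri : r ≠ ρ (some i) := fun h => hr' ⟨_, h.symm⟩
    simp [Instr.exec, hri]

theorem Cmd.simulates_put (d e : Expr ι) (ht : ∀ i, ρ i < t)
    (hcode : CodeAt P o ((put d e).compile ρ t o)) (hpc : m.pc = o) (hs : Represents ρ n s m) :
    Simulates ρ P ((put d e).cost.eval n) t m (o + ((put d e).compile ρ t o).length) n
      ((put d e).eval n s) := by
  obtain ⟨hde, hstore, -⟩ := codeAt_append.mp hcode
  obtain ⟨hd, he⟩ := codeAt_append.mp hde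
  rw [cost, eval_add, eval_add, eval_one]
  refine ((d.yields_compile ht hd hpc hs).two fun m' hpc' hagree =>
    e.yields_compile (fun i => (ht i).trans t.lt_succ_self) he hpc' (hs.of_agree ht hagree)).bind ?_
  rintro ⟨pc, reg, mem⟩ ⟨rfl, hvd, hve, hagree⟩
  rw [List.length_append, ← add_assoc] at hstore
  have hs' := hs.of_agree ht hagree
  refine Reaches.step hstore (Reaches.here (b := 0) ⟨?_, ⟨hs'.order, hs'.var, ?_⟩, fun r hr _ =>
    hagree.reg r hr⟩)
  · simp [Instr.exec, compile, add_assoc]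
  · have hmem : mem = s.mem := hs'.mem
    simp_all [Instr.exec, eval, State.put]

theorem Cmd.simulates_loop (i : ι) (c : Cmd ι) (hρ : ρ.Injective) (ht : ∀ j, ρ j < t)
    (hcode : CodeAt P o ((loop i c).compile ρ t o))
    (hbody : ∀ (m' : Config) (s' : State ι), m'.pc = o + 7 → Represents ρ n s' m' →
      Simulates ρ P b (t + 1) m' (o + 7 + (c.compile ρ (t + 1) (o + 7)).length) n (c.eval n s'))
    (hpc : m.pc = o) (hs : Represents ρ n s m) :
    Simulates ρ P (n * (b + 2 + 4) + 3) t m (o + ((loop i c).compile ρ t o).length) n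
      ((loop i c).eval n s) := by
  let f (k : ℕ) (s' : State ι) : State ι := c.eval n (s'.set i k)
  let J (k : ℕ) (m' : Config) : Prop :=
    (∃ s', Represents ρ n s' m' ∧
      (List.range k).foldr f s' = (List.range n).foldr f s) ∧
      ∀ r < t, r ∉ Set.range ρ → m'.reg r = m.reg r
  have hJ {k : ℕ} {m₁ m₂ : Config} (h : J k m₁) (h' : Agree t m₁ m₂) : J k m₂ :=
    let ⟨⟨s', hs', heq⟩, hreg⟩ := h
    ⟨⟨s', hs'.of_agree ht h', heq⟩, fun r hr hr' => (h'.reg r hr).trans (hreg r hr hr')⟩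
  have hround (k : ℕ) (m₁ : Config) (hpc₁ : m₁.pc = o + 5) (hk : m₁.reg t = k)
      (h : J (k + 1) m₁) : Reaches P (b + 2) m₁ fun m' =>
        m'.pc = o + 7 + (c.compile ρ (t + 1) (o + 7)).length ∧ m'.reg t = k ∧ J k m' := by
    obtain ⟨⟨s', hs', heq⟩, hreg⟩ := h
    obtain ⟨hconst, hadd, -⟩ := codeAt_of_counted hcode
    have hset : Simulates ρ P 2 (t + 1) m₁ (o + 7) n (s'.set i k) :=
      simulates_set i hρ (ht _) ⟨hconst, hadd, trivial⟩ hpc₁ hs' hk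
    refine (hset.bind fun m' hpc' hs' => hbody m' _ hpc' hs').mono (by rw [add_comm])
      fun m' ⟨hpc', hs', hreg'⟩ => ⟨hpc', ?_, ?_⟩
    · exact (hreg' t t.lt_succ_self fun ⟨j, hj⟩ => (ht j).ne hj).trans hk
    · exact ⟨⟨_, hs', by rw [← heq, List.range_succ, List.foldr_append]; rfl⟩, fun r hr hr' =>
        (hreg' r (hr.trans t.lt_succ_self) hr').trans (hreg r hr hr')⟩
  refine (reaches_counted (J := J) hcode (ht none) hJ (fun k _ m₁ hpc₁ hk h => ?_) hpc hs.order
    ⟨⟨s, hs, rfl⟩, fun _ _ _ => rfl⟩).mono le_rfl fun m' ⟨hpc', ⟨s', hs', heq⟩, hreg⟩ =>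
      ⟨?_, ?_, hreg⟩
  · refine (hround k m₁ hpc₁ hk h).mono le_rfl fun m' ⟨hpc', hk', h'⟩ => ⟨?_, hk', h'⟩
    rw [hpc', List.length_cons, List.length_cons]
    ring
  · rw [hpc', compile, counted]
    simp only [List.length_append, List.length_cons, List.length_nil]
    ring
  · rwa [← show s' = (loop i c).eval n s from heq]

theorem Cmd.simulates_compile (c : Cmd ι) (hρ : ρ.Injective) (ht : ∀ i, ρ i < t)
    (hcode : CodeAt P o (c.compile ρ t o)) (hpc : m.pc = o) (hs : Represents ρ n s m) :
    Simulates ρ P (c.cost.eval n) t m (o + (c.compile ρ t o).length) n (c.eval n s) := by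
  induction c generalizing t o m s with
  | assign i e =>
    obtain ⟨he, hset⟩ := codeAt_append.mp hcode
    rw [cost, eval_add, eval_ofNat, compile, List.length_append, ← add_assoc]
    exact (e.yields_compile ht he hpc hs).bind_simulates fun m' hpc' hv hagree =>
      simulates_set i hρ (ht _) hset hpc' (hs.of_agree ht hagree) hv
  | put d e => exact simulates_put d e ht hcode hpc hs
  | seq c d ihc ihd =>
    obtain ⟨hc, hd⟩ := codeAt_append.mp hcode
    rw [cost, eval_add, compile, List.length_append, ← add_assoc]
    exact (ihc ht hc hpc hs).bind fun m' hpc' hs' => ihd ht hd hpc' hs'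
  | ifPos e c ih =>
    obtain ⟨he, hjzero, hc⟩ := codeAt_append.mp hcode
    rw [cost, eval_add]
    refine (e.yields_compile ht he hpc hs).bind_simulates fun m' hpc' hv hagree => ?_
    have hs' := hs.of_agree ht hagree
    obtain ⟨pc, reg, mem⟩ := m'
    obtain rfl := hpc'
    rw [eval_add, eval_one]
    refine Reaches.step hjzero ?_
    by_cases h : reg t = 0
    · have heval : (ifPos e c).eval n s = s := if_neg (by simp [← hv, h])
      rw [heval]
      refine Reaches.here ⟨?_, ⟨hs'.order, hs'.var, hs'.mem⟩, fun _ _ _ => rfl⟩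
      simp [Instr.exec, h, compile, add_assoc, add_comm 1]
    · have heval : (ifPos e c).eval n s = c.eval n s := if_pos (hv ▸ Nat.pos_of_ne_zero h)
      have hlength : ((ifPos e c).compile ρ t o).length = (e.compile ρ t o).length + 1 +
          (c.compile ρ t (o + (e.compile ρ t o).length + 1)).length := by
        simp [compile, add_assoc, add_comm 1]
      rw [heval, hlength, ← add_assoc, ← add_assoc]
      exact ih ht hc (if_neg h) ⟨hs'.order, hs'.var, hs'.mem⟩
  | loop i c ih =>
    rw [cost, eval_add, eval_mul, eval_add, eval_add, eval_X, eval_ofNat, eval_ofNat, eval_ofNat]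
    refine simulates_loop i c hρ ht hcode (fun m' s' hpc' hs' => ?_) hpc hs
    exact ih (fun j => (ht j).trans t.lt_succ_self) (codeAt_of_counted hcode).2.2 hpc' hs'

theorem eval_le_eval_of_le {R : Type*} [Semiring R] [PartialOrder R] [IsOrderedRing R]
    [CanonicallyOrderedAdd R] (q : R[X]) {a b : R} (h : a ≤ b) : q.eval a ≤ q.eval b := by
  rw [eval_eq_sum, eval_eq_sum]
  exact Finset.sum_le_sum fun i _ =>
    mul_le_mul_of_nonneg_left (pow_le_pow_left₀ zero_le h i) zero_le

theorem length_le_inputSize (w : List ℕ) : w.length ≤ inputSize w := by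
  induction w with
  | nil => simp
  | cons a w ih =>
    simp only [inputSize, List.length_cons, List.map_cons, List.sum_cons] at ih ⊢
    lia

theorem polyTimeComputable_of_cmd {α : Type*} {enc : α → List ℕ} {f : α → ℕ} (c : Cmd ι)
    (order : α → ℕ) (out : ι) (hρ : ρ.Injective) (ht : ∀ i, ρ i < t) (hout : ρ (some out) = 0)
    (horder : ∀ a, (init (enc a)).mem 0 = order a) (hle : ∀ a, order a ≤ (enc a).length)
    (hf : ∀ a, (c.eval (order a) ⟨fun _ => 0, (init (enc a)).mem⟩).var out = f a) :
    PolyTimeComputable enc f := by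
  let P : Program := .load (ρ none) (ρ none) :: c.compile ρ t 1
  refine ⟨P, c.cost + 1, fun a => ?_⟩
  have hinit : Represents ρ (order a) ⟨fun _ => 0, (init (enc a)).mem⟩
      ((Instr.load (ρ none) (ρ none)).exec (init (enc a))) :=
    ⟨by simpa [Instr.exec, init] using horder a, fun i => by simp [Instr.exec, init, hρ.eq_iff],
      rfl⟩
  have hsim := c.simulates_compile (P := P) hρ ht
    (codeAt_self (c.compile ρ t 1) [.load (ρ none) (ρ none)]) rfl hinit
  obtain ⟨k, hk, hpc, hs, -⟩ := hsim.step (m := init (enc a)) rfl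
  refine ⟨k, hk.trans ?_, hpc.ge.trans' (by simp [P, add_comm]), ?_⟩
  · rw [eval_add, eval_one]
    exact Nat.succ_le_succ (eval_le_eval_of_le _ ((hle a).trans (length_le_inputSize _)))
  · rw [← hf a, ← hs.var out, hout]

end Simulation

section Frames

variable {ι : Type*}

/-- What a program may change: the variables it assigns to, and the memory, which stands here as
`none`. -/
def Cmd.writes : Cmd ι → List (Option ι)
  | assign i _ => [some i]
  | put _ _ => [none]
  | seq c d => c.writes ++ d.writes
  | ifPos _ c => c.writes
  | loop i c => some i :: c.writes

/-- The states `s` and `s'` differ at most in the variables in `l`, and in the memory if `none` is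
in `l`. -/
structure Frame (l : List (Option ι)) (s s' : State ι) : Prop where
  var : ∀ i, some i ∉ l → s'.var i = s.var i
  mem : none ∉ l → s'.mem = s.mem

variable {l l' : List (Option ι)} {n : ℕ} {s s' s'' : State ι}

theorem Frame.refl (l : List (Option ι)) (s : State ι) : Frame l s s :=
  ⟨fun _ _ => rfl, fun _ => rfl⟩

theorem Frame.trans (h : Frame l s s') (h' : Frame l s' s'') : Frame l s s'' :=
  ⟨fun i hi => (h'.var i hi).trans (h.var i hi), fun hl => (h'.mem hl).trans (h.mem hl)⟩

theorem Frame.mono (h : Frame l s s') (hl : l ⊆ l') : Frame l' s s' :=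
  ⟨fun i hi => h.var i fun h => hi (hl h), fun hl' => h.mem fun h => hl' (hl h)⟩

variable [DecidableEq ι]

theorem frame_set (i : ι) (k : ℕ) : Frame [some i] s (s.set i k) :=
  ⟨fun j hj => Function.update_of_ne (by simpa using hj) _ _, fun _ => rfl⟩

theorem State.var_set_self (s : State ι) (i : ι) (k : ℕ) : (s.set i k).var i = k :=
  Function.update_self ..

theorem Cmd.eval_loop_induction {i : ι} {c : Cmd ι} (I : ℕ → State ι → Prop) (h0 : I n s)
    (hstep : ∀ (k : Fin n) s', I (k + 1) s' → I k (c.eval n (s'.set i k))) :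
    I 0 ((loop i c).eval n s) :=
  foldr_range_induction I h0 fun k hk s' => hstep ⟨k, hk⟩ s'

theorem Cmd.frame (c : Cmd ι) (n : ℕ) (s : State ι) : Frame c.writes s (c.eval n s) := by
  induction c generalizing s with
  | assign i e => exact frame_set i _
  | put a e => exact ⟨fun _ _ => rfl, fun h => absurd (List.mem_singleton_self none) h⟩
  | seq c d ihc ihd =>
    exact ((ihc s).mono (List.subset_append_left _ _)).trans
      ((ihd _).mono (List.subset_append_right _ _))
  | ifPos e c ih =>
    rw [eval]
    split_ifs
    exacts [ih s, .refl _ s]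
  | loop i c ih =>
    refine eval_loop_induction (fun _ s' => Frame _ s s') (.refl _ s) fun k s' h => h.trans ?_
    exact ((frame_set i k).mono (by simp [writes])).trans
      ((ih _).mono (List.subset_cons_self _ _))

theorem Cmd.eval_loop_induction_frame {i : ι} {c : Cmd ι} (I : ℕ → State ι → Prop) (h0 : I n s)
    (hstep : ∀ (k : Fin n) s', Frame (loop i c).writes s s' → I (k + 1) s' →
      I k (c.eval n (s'.set i k))) : I 0 ((loop i c).eval n s) := by
  refine (eval_loop_induction (fun k s' => Frame (loop i c).writes s s' ∧ I k s')
    ⟨.refl _ s, h0⟩ fun k s' ⟨h, hI⟩ => ⟨h.trans ?_, hstep k s' h hI⟩).2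
  exact ((frame_set i k).mono (by simp [writes])).trans
    ((c.frame n _).mono (List.subset_cons_self _ _))

theorem Cmd.var_eval_loop_eq_sum {i j : ι} {c : Cmd ι} (f : Fin n → ℕ)
    (hf : ∀ (k : Fin n) s', Frame (loop i c).writes s s' →
      (c.eval n (s'.set i k)).var j = s'.var j + f k) :
    ((loop i c).eval n s).var j = s.var j + ∑ k, f k := by
  let later (k : ℕ) : Finset (Fin n) := {w | k ≤ w}
  have hlast : later n = ∅ := by simp [later]
  have hall : later 0 = Finset.univ := by simp [later]
  have hnext (k : Fin n) : later k = insert k (later (k + 1)) := by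
    ext w
    simp [later, Fin.ext_iff]
    lia
  rw [← hall]
  refine eval_loop_induction_frame (fun k s' => s'.var j = s.var j + ∑ w ∈ later k, f w)
    (by simp [hlast]) fun k s' h hI => ?_
  rw [hf k s' h, hI, hnext, Finset.sum_insert (by simp [later]), add_right_comm, add_assoc]

end Frames

section Programs

/-- The variables of the program for the strong subgraph connectivity. -/
inductive Var where
  | result | source | target | tail | head | best | cheapest | taken | degree | idle | round

/-- The registers in which the variables and, as `none`, the order of the graph are kept. -/
def register : Option Var → ℕ
  | some i => i.ctorIdx
  | none => 11

theorem register_injective : register.Injective := by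
  rintro (_ | i) (_ | j) h <;> try cases i
  all_goals try cases j
  all_goals first | rfl | exact absurd h (by decide)

theorem register_lt (i : Option Var) : register i < 12 := by
  rcases i with _ | i
  · decide
  · cases i <;> decide

instance : DecidableEq Var :=
  (register_injective.comp (Option.some_injective Var)).decidableEq

variable {ι : Type*}

instance : Zero (Expr ι) := ⟨.lit 0⟩

instance : One (Expr ι) := ⟨.lit 1⟩

instance : Add (Expr ι) := ⟨.add⟩

instance : Sub (Expr ι) := ⟨.sub⟩

prefix:max "&" => Expr.var

infix:62 " ::= " => Cmd.assign

infixr:60 " ;; " => Cmd.seq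

namespace Expr

/-- The order of the graph. -/
def order : Expr ι :=
  scale 1

/-- The entry of the adjacency matrix in row `a` and column `b`. -/
def entry (a b : Expr ι) : Expr ι :=
  get (1 + scale a + b)

/-- `1` if the values of `a` and `b` are equal, and `0` otherwise. -/
def equal (a b : Expr ι) : Expr ι :=
  1 - ((a - b) + (b - a))

/-- The address of the price of the head copy of `a`. The auction is stored after the input. -/
def priceCell (a : Expr ι) : Expr ι :=
  1 + scale order + (a + a)

/-- The address of the owner of the head copy of `a`: the cell contains `u + 1` if the owner is `u`,
and `0` if there is none. -/
def ownerCell (a : Expr ι) : Expr ι :=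
  1 + priceCell a

section Eval

variable {n : ℕ} {s : State ι} (a b : Expr ι)

@[simp] theorem eval_one : (1 : Expr ι).eval n s = 1 := rfl

@[simp] theorem eval_add : (a + b).eval n s = a.eval n s + b.eval n s := rfl

@[simp] theorem eval_sub : (a - b).eval n s = a.eval n s - b.eval n s := rfl

@[simp] theorem eval_order : (order : Expr ι).eval n s = n := mul_one n

@[simp] theorem eval_entry : (entry a b).eval n s = s.mem (1 + n * a.eval n s + b.eval n s) := rfl

@[simp] theorem eval_equal :
    (equal a b).eval n s = if a.eval n s = b.eval n s then 1 else 0 := by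
  simp only [equal, eval_sub, eval_add, eval_one]
  split_ifs <;> lia

@[simp] theorem eval_priceCell :
    (priceCell a).eval n s = 1 + n * n + (a.eval n s + a.eval n s) := by
  simp [priceCell, eval]

@[simp] theorem eval_ownerCell :
    (ownerCell a).eval n s = 1 + (1 + n * n + (a.eval n s + a.eval n s)) := by
  simp [ownerCell]

end Eval

end Expr

open Var RAM.Expr

/-- The price of the head copy of `head` at the beginning of the auction. -/
def initialPrice : Expr Var :=
  order - scale (1 - (equal &head &source + equal &head &target + entry &source &head))

/-- Enter the initial auction into the memory. -/
def openAuction : Cmd Var :=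
  .loop head (.put (priceCell &head) initialPrice ;; .put (ownerCell &head) 0)

/-- Set `taken` to zero if `tail` is an idle bidder, and to a positive value otherwise. -/
def testTaken : Cmd Var :=
  taken ::= equal &tail &source + equal &tail &target + entry &tail &target ;;
  .loop head (taken ::= &taken + equal (get (ownerCell &head)) (&tail + 1))

/-- Look for a cheapest head copy that `tail` could hold. -/
def search : Cmd Var :=
  best ::= order ;;
  .loop head (.ifPos (equal &tail &head + entry &tail &head) (
    .ifPos (&best - get (priceCell &head)) (
      best ::= get (priceCell &head) ;; cheapest ::= &head)))

/-- Give `tail` an opportunity to bid. -/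
def takeTurn : Cmd Var :=
  testTaken ;; search ;; .ifPos (1 - &taken) (.ifPos (order - &best) (
    .put (priceCell &cheapest) (&best + 1) ;; .put (ownerCell &cheapest) (&tail + 1)))

/-- Run the auction until it is over. -/
def runAuction : Cmd Var :=
  .loop round (.loop round (.loop tail takeTurn))

/-- Count the neighbours of `source` and the idle bidders. -/
def count : Cmd Var :=
  degree ::= 0 ;; idle ::= 0 ;;
  .loop tail (
    degree ::= &degree + entry &source &tail ;; testTaken ;; idle ::= &idle + (1 - &taken))

/-- Lower `result` to the strong connectivity between `source` and `target` if these are distinct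
and it is smaller. -/
def updateResult : Cmd Var :=
  .ifPos (1 - equal &source &target) (openAuction ;; runAuction ;; count ;;
    .ifPos (&result - (&degree - &idle)) (result ::= &degree - &idle))

/-- Compute the strong subgraph 2-connectivity. -/
def computeConnectivity : Cmd Var :=
  result ::= order ;; .loop source (.loop target updateResult)

end Programs

section Correctness

open Var RAM.Expr

variable {n : ℕ} {G : SimpleGraph (Fin n)} {x y u v : Fin n} {A : Auction (Fin n)}
  {l : List (Option Var)} {s s' : State Var} {m : ℕ → ℕ}

open Classical in
/-- The memory contains the adjacency matrix of `G` in its place. -/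
def HasInput (G : SimpleGraph (Fin n)) (m : ℕ → ℕ) : Prop :=
  ∀ i j : Fin n, m (1 + n * i + j) = if G.Adj i j then 1 else 0

theorem HasInput.update (h : HasInput G m) {a : ℕ} (ha : 1 + n * n ≤ a) (b : ℕ) :
    HasInput G (Function.update m a b) := by
  intro i j
  have hlt : n * i + j < n * n :=
    calc n * i + j < n * (i + 1) := by rw [mul_add_one]; exact Nat.add_lt_add_left j.2 _
      _ ≤ n * n := Nat.mul_le_mul_left n i.2
  rw [Function.update_of_ne (by lia), h i j]

/-- The address of the price of the head copy of `v`, which the address of its owner follows. -/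
def cell (v : Fin n) : ℕ :=
  1 + n * n + (v + v)

theorem update_update_cell (m : ℕ → ℕ) (v w : Fin n) (p o : ℕ) :
    Function.update (Function.update m (cell v) p) (1 + cell v) o (cell w) =
      Function.update (fun w => m (cell w)) v p w := by
  have hcell : cell w ≠ 1 + cell v := by unfold cell; lia
  obtain rfl | hw := eq_or_ne w v
  · rw [Function.update_of_ne hcell, Function.update_self, Function.update_self]
  · have hcell' : cell w ≠ cell v := fun h => hw (by unfold cell at h; lia)
    rw [Function.update_of_ne hcell, Function.update_of_ne hcell', Function.update_of_ne hw]

theorem update_update_succ_cell (m : ℕ → ℕ) (v w : Fin n) (p o : ℕ) :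
    Function.update (Function.update m (cell v) p) (1 + cell v) o (1 + cell w) =
      Function.update (fun w => m (1 + cell w)) v o w := by
  obtain rfl | hw := eq_or_ne w v
  · rw [Function.update_self, Function.update_self]
  · have hcell : 1 + cell w ≠ 1 + cell v := fun h => hw (by unfold cell at h; lia)
    have hcell' : 1 + cell w ≠ cell v := by unfold cell; lia
    rw [Function.update_of_ne hcell, Function.update_of_ne hcell', Function.update_of_ne hw]

theorem HasInput.update_cells (h : HasInput G m) (v : Fin n) (p o : ℕ) :
    HasInput G (Function.update (Function.update m (cell v) p) (1 + cell v) o) :=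
  (h.update (by unfold cell; lia) p).update (by unfold cell; lia) o

/-- The state `s` stores the pair `x`, `y` and the stage `A` of the auction for it. -/
structure Stores (G : SimpleGraph (Fin n)) (x y : Fin n) (A : Auction (Fin n)) (s : State Var) :
    Prop where
  input : HasInput G s.mem
  var_source : s.var source = x
  var_target : s.var target = y
  mem_price : ∀ v, s.mem (cell v) = A.price v
  mem_owner : ∀ v, s.mem (1 + cell v) = (A.owner v).elim 0 fun u => (u : ℕ) + 1

theorem Stores.of_frame (h : Stores G x y A s) (hs : Frame l s s')
    (hl : ∀ i ∈ [some source, some target, none], i ∉ l) : Stores G x y A s' := by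
  have hmem : s'.mem = s.mem := hs.mem (hl _ (by simp))
  exact ⟨hmem ▸ h.input, (hs.var _ (hl _ (by simp))).trans h.var_source,
    (hs.var _ (hl _ (by simp))).trans h.var_target, hmem ▸ h.mem_price, hmem ▸ h.mem_owner⟩

theorem Stores.var_testTaken (h : Stores G x y A s) (hu : s.var tail = u) :
    (testTaken.eval n s).var taken = 0 ↔ u ∈ A.idle G x y := by
  have hsum : (testTaken.eval n s).var taken =
      (s.set taken ((equal &tail &source + equal &tail &target + entry &tail &target).eval n s)).var
        taken + ∑ v : Fin n, if A.owner v = some u then 1 else 0 := by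
    refine Cmd.var_eval_loop_eq_sum _ fun v s' hs' => ?_
    have howner : s'.mem (1 + (1 + n * n + (v + v))) = (A.owner v).elim 0 fun u => (u : ℕ) + 1 :=
      (congrFun (hs'.mem (by decide)) _).trans (h.mem_owner v)
    have htail : s'.var tail = u := (hs'.var _ (by decide)).trans hu
    cases hv : A.owner v <;>
      simp [Cmd.eval, Expr.eval, State.set, howner, htail, hv, Fin.val_inj]
  rw [hsum]
  simp [State.set, Expr.eval, hu, h.var_source, h.var_target, h.input u y, Fin.val_inj,
    Auction.idle, unmatched, leftPart, Auction.Owns, and_assoc]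

/-- What a search for a cheapest head copy for `u` among those in `W` has to find. -/
structure Found (G : SimpleGraph (Fin n)) (A : Auction (Fin n)) (u : Fin n) (W : Set (Fin n))
    (s : State Var) : Prop where
  best_le : ∀ w ∈ W, SplitAdj G u w → s.var best ≤ A.price w
  best_eq : s.var best = n ∨ ∃ v, SplitAdj G u v ∧ s.var cheapest = v ∧ s.var best = A.price v

theorem Stores.found_search (h : Stores G x y A s) (hu : s.var tail = u) :
    Found G A u Set.univ (search.eval n s) := by
  have hinit : Found G A u {w | n ≤ w} (s.set best (order.eval n s)) :=
    ⟨fun w hw => absurd w.2 hw.not_gt, .inl (by simp [State.set])⟩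
  rw [← show {w : Fin n | 0 ≤ w.val} = Set.univ by simp]
  refine Cmd.eval_loop_induction_frame (fun k => Found G A u {w | k ≤ w}) hinit
    fun v s' hs' hfound => ?_
  have hprice : s'.mem (1 + n * n + (v + v)) = A.price v :=
    (congrFun (hs'.mem (by decide)) _).trans (h.mem_price v)
  have hentry := (congrFun (hs'.mem (by decide)) _).trans (h.input u v)
  have htail : s'.var tail = u := (hs'.var _ (by decide)).trans hu
  have hsplit : 0 < (equal &tail &head + entry &tail &head).eval n (s'.set head v) ↔
      SplitAdj G u v := by
    by_cases huv : u = v <;> by_cases hadj : G.Adj u v <;>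
      simp [State.set, SplitAdj, Expr.eval, htail, hentry, Fin.val_inj, huv, hadj]
  have hless : 0 < (&best - get (priceCell &head)).eval n (s'.set head v) ↔
      A.price v < s'.var best := by
    simp [State.set, Expr.eval, hprice]
  have hmem {w : Fin n} (hw : v.val ≤ w) : w = v ∨ v.val + 1 ≤ w := by lia
  simp only [Cmd.eval, hsplit, hless, ← ite_and]
  split_ifs with hv <;> rw [hsplit] at hv
  · have hle (w : Fin n) (hw : v.val ≤ w) (huw : SplitAdj G u w) : A.price v ≤ A.price w := by
      obtain rfl | hw := hmem hw
      exacts [le_rfl, hv.2.le.trans (hfound.best_le w hw huw)]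
    exact ⟨by simpa [State.set, Expr.eval, hprice] using hle,
      .inr ⟨v, hv.1, by simp [State.set, Expr.eval, hprice]⟩⟩
  · refine ⟨fun w hw huw => ?_, hfound.best_eq⟩
    obtain rfl | hw := hmem hw
    exacts [not_lt.mp fun hlt => hv ⟨huw, hlt⟩, hfound.best_le w hw huw]

theorem Stores.bid (h : Stores G x y A s) (hbest : s.var best = A.price v)
    (hcheapest : s.var cheapest = v) (hu : s.var tail = u) :
    Stores G x y (A.bid u v) ((Cmd.put (priceCell &cheapest) (&best + 1) ;;
      .put (ownerCell &cheapest) (&tail + 1)).eval n s) := by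
  have hmem : ((Cmd.put (priceCell &cheapest) (&best + 1) ;;
      .put (ownerCell &cheapest) (&tail + 1)).eval n s).mem =
      Function.update (Function.update s.mem (cell v) (A.price v + 1)) (1 + cell v) (u + 1) := by
    simp [cell, Cmd.eval, State.put, Expr.eval, hbest, hcheapest, hu]
  refine ⟨?_, h.var_source, h.var_target, fun w => ?_, fun w => ?_⟩ <;> rw [hmem]
  · exact h.input.update_cells v _ _
  · rw [update_update_cell, funext h.mem_price, Auction.bid]
  · rw [update_update_succ_cell, funext h.mem_owner, Auction.bid]
    exact (Function.apply_update (fun _ o => Option.elim o 0 fun u => u.val + 1) A.owner v (some u)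
      w).symm

theorem Stores.isBid_takeTurn (h : Stores G x y A s) (hu : s.var tail = u) :
    ∃ A', Auction.IsBid G x y u A A' ∧ Stores G x y A' (takeTurn.eval n s) := by
  let s₁ := testTaken.eval n s
  let s₂ := search.eval n s₁
  have hs₁ : Frame testTaken.writes s s₁ := testTaken.frame n s
  have hs₂ : Frame search.writes s₁ s₂ := search.frame n s₁
  have h₁ : Stores G x y A s₁ := h.of_frame hs₁ (by decide)
  have h₂ : Stores G x y A s₂ := h₁.of_frame hs₂ (by decide)
  have hu₁ : s₁.var tail = u := (hs₁.var _ (by decide)).trans hu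
  have hu₂ : s₂.var tail = u := (hs₂.var _ (by decide)).trans hu₁
  have hidle : 0 < (1 - &taken).eval n s₂ ↔ u ∈ A.idle G x y := by
    rw [← h.var_testTaken hu, ← show s₂.var taken = s₁.var taken from hs₂.var _ (by decide)]
    simp [Expr.eval]
  have hopen : 0 < (order - &best).eval n s₂ ↔ s₂.var best < n := by simp [Expr.eval]
  have hfound : Found G A u Set.univ s₂ := h₁.found_search hu₁
  change ∃ A', Auction.IsBid G x y u A A' ∧ Stores G x y A' (Cmd.eval n (.ifPos _ _) s₂)
  rw [Cmd.eval, Cmd.eval]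
  simp only [Auction.IsBid, Nat.card_fin, hopen]
  split_ifs with hidle' hbest
  · obtain ⟨v, huv, hv, hprice⟩ := hfound.best_eq.resolve_left hbest.ne
    exact ⟨_, .inr ⟨hidle.mp hidle', v, huv, hprice ▸ hbest, fun w hw =>
      hprice ▸ hfound.best_le w (Set.mem_univ w) hw, rfl⟩, h₂.bid hprice hv hu₂⟩
  · refine ⟨A, .inl ⟨fun _ v huv => ?_, rfl⟩, h₂⟩
    rw [Nat.card_fin]
    exact (not_lt.mp hbest).trans (hfound.best_le v (Set.mem_univ v) huv)
  · exact ⟨A, .inl ⟨fun hu => absurd (hidle.mpr hu) hidle', rfl⟩, h₂⟩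

/-- The program `c` carries out `k` rounds of an auction that is stored in the memory. -/
def RunsRounds (G : SimpleGraph (Fin n)) (x y : Fin n) (k : ℕ) (c : Cmd Var) : Prop :=
  ∀ {A s}, A.Valid G x y → Stores G x y A s →
    ∃ A', A'.Valid G x y ∧ Auction.Rounds G x y k A A' ∧ Stores G x y A' (c.eval n s)

theorem runsRounds_loop_takeTurn (G : SimpleGraph (Fin n)) (x y : Fin n) :
    RunsRounds G x y 1 (.loop tail takeTurn) := by
  intro A s hA hs
  obtain ⟨A', hA', hround, hs'⟩ := Cmd.eval_loop_induction
    (fun k s' => ∃ A', A'.Valid G x y ∧ Auction.Round G x y {w | k ≤ w} A A' ∧ Stores G x y A' s')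
    ⟨A, hA, .inl ⟨fun w hw => absurd w.2 hw.not_gt, rfl⟩, hs⟩ fun u s' ⟨A', hA', hround, hs'⟩ => by
      obtain ⟨A'', hbid, hs''⟩ := (hs'.of_frame (frame_set tail u) (by decide)).isBid_takeTurn
        (s'.var_set_self tail u)
      refine ⟨A'', hA'.of_isBid hbid, ?_, hs''⟩
      rw [show {w : Fin n | u.val ≤ w} = insert u {w : Fin n | u.val + 1 ≤ w} by
        ext w
        simp
        lia]
      exact hround.insert hbid
  exact ⟨A', hA', Auction.Round.rounds_one (by simpa using hround), hs'⟩

theorem RunsRounds.loop_round {k : ℕ} {c : Cmd Var} (hc : RunsRounds G x y k c) :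
    RunsRounds G x y (n * k) (.loop round c) := by
  intro A s hA hs
  obtain ⟨A', hA', hrounds, hs'⟩ := Cmd.eval_loop_induction (n := n)
    (fun i s' => ∃ A', A'.Valid G x y ∧ Auction.Rounds G x y ((n - i) * k) A A' ∧
      Stores G x y A' s')
    ⟨A, hA, ⟨fun _ => rfl, .inr (by simp)⟩, hs⟩ fun i s' ⟨A', hA', hrounds, hs'⟩ => by
      obtain ⟨A'', hA'', hrounds', hs''⟩ := hc hA' (hs'.of_frame (frame_set round i) (by decide))
      refine ⟨A'', hA'', ?_, hs''⟩
      rw [show n - i.val = n - (i + 1) + 1 by lia, add_one_mul]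
      exact hrounds.trans hrounds'
  exact ⟨A', hA', hrounds, hs'⟩

theorem Stores.finished_runAuction (hs : Stores G x y A s) (hA : A.Valid G x y) :
    ∃ A', A'.Valid G x y ∧ A'.Finished G x y ∧ Stores G x y A' (runAuction.eval n s) := by
  obtain ⟨A', hA', hrounds, hs'⟩ :=
    RunsRounds.loop_round (RunsRounds.loop_round (runsRounds_loop_takeTurn G x y)) hA hs
  exact ⟨A', hA', hA'.finished_of_rounds (by simpa using hrounds), hs'⟩

theorem HasInput.eval_initialPrice (hG : HasInput G s.mem) (hv : s.var head = v)
    (hx : s.var source = x) (hy : s.var target = y) :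
    initialPrice.eval n s = (Auction.initial G x y).price v := by
  classical
  have heval : initialPrice.eval n s = n - n * (1 - ((if v = x then 1 else 0) +
      (if v = y then 1 else 0) + if G.Adj x v then 1 else 0)) := by
    simp [initialPrice, Expr.eval, hv, hx, hy, hG x v, Fin.val_inj]
  rw [heval]
  simp only [Auction.initial, rightPart, Set.mem_ofPred_eq, Nat.card_fin]
  split_ifs <;> simp_all

theorem HasInput.stores_openAuction (hG : HasInput G s.mem) (hx : s.var source = x)
    (hy : s.var target = y) : Stores G x y (.initial G x y) (openAuction.eval n s) := by
  have hcells := Cmd.eval_loop_induction_frame (s := s) (i := head)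
    (c := .put (priceCell &head) initialPrice ;; .put (ownerCell &head) 0)
    (fun k s' => HasInput G s'.mem ∧ ∀ v : Fin n, k ≤ v →
      s'.mem (cell v) = (Auction.initial G x y).price v ∧ s'.mem (1 + cell v) = 0)
    ⟨hG, fun v hv => absurd v.2 hv.not_gt⟩ fun v s' hs' ⟨hG', hlater⟩ => by
      have hprice : initialPrice.eval n (s'.set head v) = (Auction.initial G x y).price v :=
        HasInput.eval_initialPrice (s := s'.set head v) hG' (s'.var_set_self head v)
          ((hs'.var _ (by decide)).trans hx) ((hs'.var _ (by decide)).trans hy)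
      have hmem : ((Cmd.put (priceCell &head) initialPrice ;; .put (ownerCell &head) 0).eval n
          (s'.set head v)).mem = Function.update (Function.update s'.mem (cell v)
            ((Auction.initial G x y).price v)) (1 + cell v) 0 := by
        rw [← hprice]
        simp [cell, Cmd.eval, State.put, State.set, Expr.eval]
      rw [hmem]
      refine ⟨hG'.update_cells v _ _, fun w hw => ?_⟩
      rw [update_update_cell, update_update_succ_cell]
      obtain rfl | hwv := eq_or_ne w v
      · simp
      · simpa [hwv] using hlater w (Nat.lt_of_le_of_ne hw (Fin.val_ne_of_ne hwv.symm))
  have hframe : Frame openAuction.writes s (openAuction.eval n s) := openAuction.frame n s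
  exact ⟨hcells.1, (hframe.var _ (by decide)).trans hx, (hframe.var _ (by decide)).trans hy,
    fun v => (hcells.2 v v.val.zero_le).1, fun v => (hcells.2 v v.val.zero_le).2⟩

open Classical in
theorem var_eval_loop_eq_ncard {i j : Var} {c : Cmd Var} (X : Set (Fin n)) (hj : s.var j = 0)
    (hX : ∀ (k : Fin n) s', Frame (Cmd.loop i c).writes s s' →
      (c.eval n (s'.set i k)).var j = s'.var j + if k ∈ X then 1 else 0) :
    ((Cmd.loop i c).eval n s).var j = X.ncard := by
  rw [Cmd.var_eval_loop_eq_sum _ hX, hj, zero_add, Finset.sum_boole, Set.ncard_eq_toFinset_card']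
  simp

theorem Stores.var_degree_count (h : Stores G x y A s) :
    (count.eval n s).var degree = (G.neighborSet x).ncard := by
  refine var_eval_loop_eq_ncard _ rfl fun v s' hs' => ?_
  let step : Cmd Var := degree ::= &degree + entry &source &tail
  have hframe := (testTaken ;; idle ::= &idle + (1 - &taken)).frame n (step.eval n (s'.set tail v))
  refine (hframe.var degree (by decide)).trans ?_
  have hentry := (congrFun (hs'.mem (by decide)) _).trans (h.input x v)
  have hsource : s'.var source = x := (hs'.var _ (by decide)).trans h.var_source
  simp [step, Cmd.eval, Expr.eval, State.set, hsource, hentry]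
  rfl

theorem Stores.var_idle_count (h : Stores G x y A s) :
    (count.eval n s).var idle = (A.idle G x y).ncard := by
  refine var_eval_loop_eq_ncard _ rfl fun u s' hs' => ?_
  let s₁ := (degree ::= &degree + entry &source &tail).eval n (s'.set tail u)
  have hs₁ : Frame _ (s'.set tail u) s₁ := Cmd.frame _ n _
  have hs₂ : Frame testTaken.writes s₁ (testTaken.eval n s₁) := Cmd.frame _ n _
  have hinit := h.of_frame ((degree ::= 0 ;; idle ::= 0).frame n s) (by decide)
  have hstart := (hinit.of_frame hs' (by decide)).of_frame (frame_set tail u) (by decide)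
  have hidle : (testTaken.eval n s₁).var idle = s'.var idle :=
    (hs₂.var _ (by decide)).trans (hs₁.var _ (by decide))
  change ((testTaken.eval n s₁).set idle _).var idle = _
  rw [State.var_set_self, ← (hstart.of_frame hs₁ (by decide)).var_testTaken (u := u) rfl]
  simp only [eval_sub, Expr.eval]
  split_ifs <;> lia

theorem Stores.degree_sub_idle (h : Stores G x y A s) (hA : A.Valid G x y)
    (hfin : A.Finished G x y) (hxy : x ≠ y) :
    (&degree - &idle).eval n (count.eval n s) =
      G.completeBiorientation.localStrongConnectivity {x, y} := by
  rw [eval_sub, Expr.eval, Expr.eval, h.var_degree_count, h.var_idle_count,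
    ← hA.localStrongConnectivity_add_ncard_idle hfin hxy, Nat.add_sub_cancel]

theorem HasInput.var_result_updateResult (hG : HasInput G s.mem) (hx : s.var source = x)
    (hy : s.var target = y) : (updateResult.eval n s).var result = if x = y then s.var result else
      min (s.var result) (G.completeBiorientation.localStrongConnectivity {x, y}) := by
  have hne : 0 < (1 - equal &source &target).eval n s ↔ x ≠ y := by
    simp [Expr.eval, hx, hy, Fin.val_inj]
  rw [updateResult, Cmd.eval]
  by_cases hxy : x = y
  · rw [if_neg (mt hne.mp (not_not.mpr hxy)), if_pos hxy]
  rw [if_pos (hne.mpr hxy), if_neg hxy]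
  obtain ⟨A, hA, hfin, hs⟩ := (hG.stores_openAuction hx hy).finished_runAuction
    (Auction.valid_initial G x y)
  let s₁ := count.eval n (runAuction.eval n (openAuction.eval n s))
  have hvalue : (&degree - &idle).eval n s₁ = _ := hs.degree_sub_idle hA hfin hxy
  have hresult : s₁.var result = s.var result :=
    ((openAuction ;; runAuction ;; count).frame n s).var _ (by decide)
  change (Cmd.eval n (.ifPos _ _) s₁).var result = _
  rw [Cmd.eval, eval_sub, hvalue, Expr.eval, hresult]
  split_ifs with hlt
  · rw [Cmd.eval, State.var_set_self, hvalue, min_eq_right (Nat.sub_pos_iff_lt.mp hlt).le]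
  · rw [hresult, min_eq_left (by lia)]

theorem HasInput.updateResult (hG : HasInput G s.mem) (hx : s.var source = x)
    (hy : s.var target = y) : HasInput G (updateResult.eval n s).mem := by
  rw [RAM.updateResult, Cmd.eval]
  split_ifs
  · obtain ⟨A, -, -, hs⟩ := (hG.stores_openAuction hx hy).finished_runAuction
      (Auction.valid_initial G x y)
    have hs' := hs.of_frame ((count ;; .ifPos (&result - (&degree - &idle))
      (result ::= &degree - &idle)).frame n _) (by decide)
    exact hs'.input
  · exact hG

/-- The state `s` of the computation after the pairs in `U` have been examined: `result` is the
minimum of the order of the graph and the strong connectivities between them. -/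
structure Examined (G : SimpleGraph (Fin n)) (U : Set (Fin n × Fin n)) (s : State Var) : Prop where
  input : HasInput G s.mem
  le_result : ∀ k, k ≤ s.var result ↔ k ≤ n ∧ ∀ p ∈ U, p.1 ≠ p.2 →
    k ≤ G.completeBiorientation.localStrongConnectivity {p.1, p.2}

theorem Examined.of_frame {U : Set (Fin n × Fin n)} (h : Examined G U s) (hs : Frame l s s')
    (hl : ∀ i ∈ [some result, none], i ∉ l) : Examined G U s' := by
  refine ⟨hs.mem (hl _ (by simp)) ▸ h.input, ?_⟩
  rw [hs.var _ (hl _ (by simp))]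
  exact h.le_result

theorem Examined.insert {U : Set (Fin n × Fin n)} (h : Examined G U s) (hx : s.var source = x)
    (hy : s.var target = y) : Examined G (insert (x, y) U) (updateResult.eval n s) := by
  refine ⟨h.input.updateResult hx hy, fun k => ?_⟩
  rw [h.input.var_result_updateResult hx hy, Set.forall_mem_insert, and_left_comm]
  split_ifs with hxy
  · rw [h.le_result, and_iff_right fun hne => absurd hxy hne]
  · rw [le_min_iff, h.le_result, forall_prop_of_true hxy, and_comm]

theorem Examined.row (h : Examined G {p | x.val + 1 ≤ p.1} s) :
    Examined G {p | x.val ≤ p.1} ((Cmd.loop target updateResult).eval n (s.set source x)) := by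
  have hinner : Examined G {p | x.val + 1 ≤ p.1 ∨ p.1 = x ∧ 0 ≤ p.2.val}
      ((Cmd.loop target updateResult).eval n (s.set source x)) := by
    refine Cmd.eval_loop_induction_frame
      (fun k => Examined G {p | x.val + 1 ≤ p.1 ∨ p.1 = x ∧ k ≤ p.2.val}) ?_ fun y s' hs' h' => ?_
    · convert h.of_frame (frame_set source x.val) (by decide) using 3 with p
      lia
    · have hsource : (s'.set target y).var source = x := (hs'.var source (by decide)).trans
        (s.var_set_self source x)
      convert (h'.of_frame (frame_set target y.val) (by decide)).insert hsource
        (s'.var_set_self target y) using 1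
      ext p
      simp [Prod.ext_iff]
      lia
  convert hinner using 3 with p
  lia

theorem HasInput.examined_computeConnectivity (hG : HasInput G s.mem) :
    Examined G Set.univ (computeConnectivity.eval n s) := by
  have hrows : Examined G {p | 0 ≤ p.1.val} (computeConnectivity.eval n s) := by
    refine Cmd.eval_loop_induction (fun k => Examined G {p | k ≤ p.1.val}) ⟨hG, fun k => ?_⟩
      fun x s' h => h.row
    rw [Cmd.eval, State.var_set_self, eval_order]
    simp
  simpa using hrows

end Correctness

end RAM

theorem RAM.HasInput.var_result_computeConnectivity {n : ℕ} {G : SimpleGraph (Fin n)} (hn : 2 ≤ n)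
    {s : State Var} (hG : HasInput G s.mem) :
    (computeConnectivity.eval n s).var .result = G.completeBiorientation.strongConnectivity 2 := by
  have : Nontrivial (Fin n) := Fin.nontrivial_iff_two_le.mpr hn
  refine eq_of_forall_le_iff fun k => ?_
  rw [hG.examined_computeConnectivity.le_result, le_strongConnectivity_two_iff]
  refine ⟨fun h x y => h.2 (x, y) (Set.mem_univ _), fun h => ⟨?_, fun p _ => h p.1 p.2⟩⟩
  simpa using (le_strongConnectivity_two_iff.mpr h).trans (strongConnectivity_two_le_card G)

namespace FiniteGraph

theorem hasInput (G : FiniteGraph) : RAM.HasInput G.graph (RAM.init G.encode).mem := by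
  classical
  intro i j
  let k : Fin (G.n * G.n) := finProdFinEquiv (i, j)
  have hi : k.divNat = i := congrArg Prod.fst (finProdFinEquiv.symm_apply_apply (i, j))
  have hj : k.modNat = j := congrArg Prod.snd (finProdFinEquiv.symm_apply_apply (i, j))
  have hk : 1 + G.n * i + j = k + 1 := by rw [finProdFinEquiv_apply_val]; lia
  simp only [RAM.init, encode, hk, List.getD_cons_succ]
  rw [List.getD_eq_getElem _ _ (by simp), List.getElem_ofFn, Fin.eta, hi, hj]

theorem n_le_length_encode (G : FiniteGraph) : G.n ≤ G.encode.length := by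
  simpa [encode] using (Nat.le_mul_self G.n).trans (Nat.le_succ _)

end FiniteGraph

theorem mainTheorem8 :
    RAM.PolyTimeComputable FiniteGraph.encode
      (fun G : FiniteGraph => G.graph.completeBiorientation.strongConnectivity 2) :=
  RAM.polyTimeComputable_of_cmd RAM.computeConnectivity FiniteGraph.n .result
    RAM.register_injective RAM.register_lt rfl (fun _ => rfl) FiniteGraph.n_le_length_encode
    fun G => G.hasInput.var_result_computeConnectivity G.two_le
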